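/- Let $\mathfrak{B}_{3,c}$ be the complex Lie algebra with basis $\{l_m, T_m : m\in\mathbb{Z}\}\cup\{c'_L\}$, where $c'_L$ is central and $$[l_m,l_n]=(m-n)\,l_{m+n},\qquad [l_m,T_n]=(m-n)\,T_{m+n}+\delta_{m+n,0}\,(m^3-m)\,c'_L,\qquad [T_m,T_n]=0$$ (the centrally extended three-dimensional BMS algebra). Let $\mathfrak{B}_{3,c}$ act on $\bigwedge^2\mathfrak{B}_{3,c}$ by $x\cdot(a\wedge b)=[x,a]\wedge b+a\wedge[x,b]$. Let $H^1(\mathfrak{B}_{3,c},\bigwedge^2\mathfrak{B}_{3,c})$ be the first Chevalley–Eilenberg cohomology group: the linear maps $\delta:\mathfrak{B}_{3,c}\to\bigwedge^2\mathfrak{B}_{3,c}$ with $\delta([x,y])=x\cdot\delta(y)-y\cdot\delta(x)$ (cocycles), modulo the maps $x\mapsto x\cdot r$ with $r\in\bigwedge^2\mathfrak{B}_{3,c}$ (coboundaries). For $\alpha\in\mathbb{C}$ let $\delta_\alpha:\mathfrak{B}_{3,c}\to\bigwedge^2\mathfrak{B}_{3,c}$ be the linear map with $$\delta_\alpha(l_m)=0,\qquad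 \delta_\alpha(T_m)=\alpha\, c'_L\wedge T_m\quad(m\in\mathbb{Z}),\qquad \delta_\alpha(c'_L)=0.$$ Then every $\delta_\alpha$ is a cocycle, $\delta_\alpha$ is not a coboundary when $\alpha\neq0$, and every class in $H^1(\mathfrak{B}_{3,c},\bigwedge^2\mathfrak{B}_{3,c})$ is the class of $\delta_\alpha$ for exactly one $\alpha\in\mathbb{C}$. In particular $\dim_{\mathbb{C}} H^1(\mathfrak{B}_{3,c},\bigwedge^2\mathfrak{B}_{3,c})=1$. -/

import Mathlib

/-! ### The exterior square of a Lie module -/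

/-- The exterior square `⋀² M` of a module, that is, Mathlib's second exterior power. It is given a
name of its own so that instances on it are found by name. -/
def ExteriorSquare (R M : Type*) [CommRing R] [AddCommGroup M] [Module R M] : Type _ :=
  ⋀[R]^2 M

section ExteriorSquare

variable {R L M : Type*} [CommRing R] [LieRing L] [LieAlgebra R L]
  [AddCommGroup M] [Module R M] [LieRingModule L M] [LieModule R L M]

noncomputable instance : AddCommGroup (ExteriorSquare R M) :=
  inferInstanceAs (AddCommGroup (⋀[R]^2 M))

noncomputable instance : Module R (ExteriorSquare R M) :=
  inferInstanceAs (Module R (⋀[R]^2 M))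

/-- The tautological identification of `ExteriorSquare R M` with Mathlib's exterior power. -/
noncomputable def exteriorSquareEquiv : ⋀[R]^2 M ≃ₗ[R] ExteriorSquare R M where
  toFun t := t
  invFun t := t
  map_add' _ _ := rfl
  map_smul' _ _ := rfl
  left_inv _ := rfl
  right_inv _ := rfl

/-- The alternating map `(a, b) ↦ a ∧ b`. -/
noncomputable def wedgeMap (R M : Type*) [CommRing R] [AddCommGroup M] [Module R M] :
    M [⋀^Fin 2]→ₗ[R] ExteriorSquare R M :=
  (exteriorSquareEquiv (R := R) (M := M)).toLinearMap.compAlternatingMap (exteriorPower.ιMulti R 2)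

/-- The decomposable element `a ∧ b` of the exterior square `⋀² M`. -/
noncomputable def wedge (R : Type*) [CommRing R] {M : Type*} [AddCommGroup M] [Module R M]
    (a b : M) : ExteriorSquare R M :=
  wedgeMap R M ![a, b]

theorem wedge_add_left (a a' b : M) : wedge R (a + a') b = wedge R a b + wedge R a' b := by
  have h := (wedgeMap R M).map_update_add ![a, b] 0 a a'
  have e (t : M) : Function.update ![a, b] 0 t = ![t, b] := by
    funext i; fin_cases i <;> simp
  rwa [e, e, e] at h

theorem wedge_smul_left (c : R) (a b : M) : wedge R (c • a) b = c • wedge R a b := by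
  have h := (wedgeMap R M).map_update_smul ![a, b] 0 c a
  have e (t : M) : Function.update ![a, b] 0 t = ![t, b] := by
    funext i; fin_cases i <;> simp
  rwa [e, e] at h

theorem wedge_self (a : M) : wedge R a a = 0 :=
  (wedgeMap R M).map_eq_zero_of_eq ![a, a] (i := 0) (j := 1) rfl (by decide)

theorem wedge_swap (a b : M) : wedge R a b = -wedge R b a := by
  have h := (wedgeMap R M).map_swap ![b, a] (i := 0) (j := 1) (by decide)
  have e : (![b, a] ∘ Equiv.swap (0 : Fin 2) 1) = ![a, b] := by
    funext i; fin_cases i <;> simp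
  rw [e] at h
  exact h

theorem wedge_add_right (a b b' : M) : wedge R a (b + b') = wedge R a b + wedge R a b' := by
  rw [wedge_swap, wedge_add_left, neg_add, ← wedge_swap, ← wedge_swap]

theorem wedge_smul_right (c : R) (a b : M) : wedge R a (c • b) = c • wedge R a b := by
  rw [wedge_swap, wedge_smul_left, wedge_swap a b, smul_neg]

/-- The alternating map `(a, b) ↦ ⁅x, a⁆ ∧ b + a ∧ ⁅x, b⁆`. -/
noncomputable def exteriorSquareActionAux (x : L) : M [⋀^Fin 2]→ₗ[R] ExteriorSquare R M where
  toFun v := wedge R ⁅x, v 0⁆ (v 1) + wedge R (v 0) ⁅x, v 1⁆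
  map_update_add' v i a b := by
    rename_i inst
    obtain rfl := Subsingleton.elim inst (instDecidableEqFin 2)
    fin_cases i <;> simp [wedge_add_left, wedge_add_right] <;> abel
  map_update_smul' v i c a := by
    rename_i inst
    obtain rfl := Subsingleton.elim inst (instDecidableEqFin 2)
    fin_cases i <;> simp [wedge_smul_left, wedge_smul_right]
  map_eq_zero_of_eq' v i j h hij := by
    have h01 : v 0 = v 1 := by
      fin_cases i <;> fin_cases j <;> simp_all
    rw [h01, wedge_swap ⁅x, v 1⁆ (v 1), neg_add_cancel]

/-- The endomorphism `a ∧ b ↦ ⁅x, a⁆ ∧ b + a ∧ ⁅x, b⁆` of `⋀² M`, that is, the action of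
`x ⊗ 1 + 1 ⊗ x`. -/
noncomputable def exteriorSquareAction (x : L) : Module.End R (ExteriorSquare R M) :=
  exteriorPower.alternatingMapLinearEquiv (exteriorSquareActionAux x) ∘ₗ
    exteriorSquareEquiv.symm.toLinearMap

theorem exteriorSquareAction_wedge (x : L) (a b : M) :
    exteriorSquareAction x (wedge R a b) = wedge R ⁅x, a⁆ b + wedge R a ⁅x, b⁆ :=
  exteriorPower.alternatingMapLinearEquiv_apply_ιMulti _ _

theorem exteriorSquare_hom_ext {N : Type*} [AddCommGroup N] [Module R N]
    {f g : ExteriorSquare R M →ₗ[R] N} (h : ∀ a b : M, f (wedge R a b) = g (wedge R a b)) : f = g := by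
  have hc : f ∘ₗ exteriorSquareEquiv.toLinearMap = g ∘ₗ exteriorSquareEquiv.toLinearMap := by
    refine exteriorPower.linearMap_ext ?_
    ext v
    have e : v = ![v 0, v 1] := by
      funext i; fin_cases i <;> rfl
    rw [e]
    exact h (v 0) (v 1)
  ext t
  exact LinearMap.congr_fun hc t

noncomputable instance exteriorSquareLieRingModule : LieRingModule L (ExteriorSquare R M) where
  bracket x t := exteriorSquareAction x t
  add_lie x y t := by
    have : exteriorSquareAction (x + y) =
        (exteriorSquareAction x + exteriorSquareAction y : Module.End R (ExteriorSquare R M)) := by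
      refine exteriorSquare_hom_ext fun a b => ?_
      simp only [LinearMap.add_apply, exteriorSquareAction_wedge, add_lie, wedge_add_left,
        wedge_add_right]
      abel
    exact LinearMap.congr_fun this t
  lie_add x := map_add _
  leibniz_lie x y t := by
    have : (exteriorSquareAction x * exteriorSquareAction y : Module.End R (ExteriorSquare R M)) =
        exteriorSquareAction ⁅x, y⁆ + exteriorSquareAction y * exteriorSquareAction x := by
      refine exteriorSquare_hom_ext fun a b => ?_
      simp only [LinearMap.add_apply, Module.End.mul_apply, exteriorSquareAction_wedge, map_add,
        leibniz_lie x y, wedge_add_left, wedge_add_right]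
      abel
    exact LinearMap.congr_fun this t

theorem lie_wedge (x : L) (a b : M) :
    ⁅x, wedge R a b⁆ = wedge R ⁅x, a⁆ b + wedge R a ⁅x, b⁆ :=
  exteriorSquareAction_wedge x a b

instance exteriorSquareLieModule : LieModule R L (ExteriorSquare R M) where
  smul_lie c x t := by
    have : exteriorSquareAction (c • x) =
        (c • exteriorSquareAction x : Module.End R (ExteriorSquare R M)) := by
      refine exteriorSquare_hom_ext fun a b => ?_
      simp only [LinearMap.smul_apply, exteriorSquareAction_wedge, smul_lie, wedge_smul_left,
        wedge_smul_right, smul_add]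
    exact LinearMap.congr_fun this t
  lie_smul c x t := map_smul _ c t

end ExteriorSquare

/-! ### First Chevalley-Eilenberg cohomology -/

section Cohomology

variable (R L M : Type*) [CommRing R] [LieRing L] [LieAlgebra R L]
  [AddCommGroup M] [Module R M] [LieRingModule L M] [LieModule R L M]

/-- The differential from 0-cochains to 1-cochains, `r ↦ (x ↦ ⁅x, r⁆)`. -/
def d₀₁ : M →ₗ[R] (L →ₗ[R] M) where
  toFun r :=
    { toFun := fun x => ⁅x, r⁆
      map_add' := fun x y => add_lie x y r
      map_smul' := fun c x => smul_lie c x r }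
  map_add' r s := by ext x; exact lie_add x r s
  map_smul' c r := by ext x; exact lie_smul c x r

/-- The 1-cocycles: linear maps `δ` with `δ ⁅x, y⁆ = ⁅x, δ y⁆ - ⁅y, δ x⁆`. -/
def oneCocycles : Submodule R (L →ₗ[R] M) :=
  LinearMap.ker (LieModule.Cohomology.d₁₂ R L M)

/-- The 1-coboundaries: the linear maps `x ↦ ⁅x, r⁆` for some `r`. -/
def oneCoboundaries : Submodule R (L →ₗ[R] M) :=
  LinearMap.range (d₀₁ R L M)

theorem oneCoboundaries_le_oneCocycles : oneCoboundaries R L M ≤ oneCocycles R L M := by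
  rintro _ ⟨r, rfl⟩
  rw [oneCocycles, LinearMap.mem_ker]
  ext x y
  simp [d₀₁]

/-- The first cohomology `H¹(L, M)`: 1-cocycles modulo 1-coboundaries. -/
abbrev H1 : Type _ :=
  oneCocycles R L M ⧸ (oneCoboundaries R L M).submoduleOf (oneCocycles R L M)

end Cohomology

/-! ### The centrally extended three-dimensional BMS algebra -/

/-- Labels of the basis of the centrally extended BMS algebra: `l m` and `T m` for `m : ℤ`, and the
central element `c`. -/
inductive BMSIndex where
  | l (m : ℤ)
  | T (m : ℤ)
  | c

/-- The underlying complex vector space of the centrally extended BMS algebra, with basis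
`l m`, `T m` (`m : ℤ`) and `c`. -/
def BMS3c : Type := BMSIndex →₀ ℂ

namespace BMS3c

noncomputable instance : AddCommGroup BMS3c := inferInstanceAs (AddCommGroup (BMSIndex →₀ ℂ))

noncomputable instance : Module ℂ BMS3c := inferInstanceAs (Module ℂ (BMSIndex →₀ ℂ))

/-- The defining basis. -/
noncomputable def basis : Module.Basis BMSIndex ℂ BMS3c := ⟨LinearEquiv.refl ℂ (BMSIndex →₀ ℂ)⟩

/-- The superrotation generators. -/
noncomputable def l (m : ℤ) : BMS3c := basis (.l m)

/-- The supertranslation generators. -/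
noncomputable def T (m : ℤ) : BMS3c := basis (.T m)

/-- The central element. -/
noncomputable def c : BMS3c := basis .c

/-- The value of `[l_m, T_n]`, namely `(m - n) T_{m+n} + δ_{m+n,0} (m³ - m) c`. -/
noncomputable def lTBracket (m n : ℤ) : BMS3c :=
  ((m : ℂ) - n) • T (m + n) + (if m + n = 0 then (m : ℂ) ^ 3 - m else 0) • c

/-- The Lie bracket on basis elements. -/
noncomputable def basisBracket : BMSIndex → BMSIndex → BMS3c
  | .l m, .l n => ((m : ℂ) - n) • l (m + n)
  | .l m, .T n => lTBracket m n
  | .T m, .l n => -lTBracket n m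
  | _, _ => 0

/-- The bilinear extension of the bracket on basis elements. -/
noncomputable def bracketHom : BMS3c →ₗ[ℂ] BMS3c →ₗ[ℂ] BMS3c :=
  basis.constr ℂ fun i => basis.constr ℂ fun j => basisBracket i j

theorem bracketHom_basis (i j : BMSIndex) :
    bracketHom (basis i) (basis j) = basisBracket i j := by
  simp [bracketHom, Module.Basis.constr_basis]

@[simp] theorem bracketHom_l_l (m n : ℤ) :
    bracketHom (l m) (l n) = ((m : ℂ) - n) • l (m + n) := bracketHom_basis _ _

@[simp] theorem bracketHom_l_T (m n : ℤ) : bracketHom (l m) (T n) =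
    ((m : ℂ) - n) • T (m + n) + (if m + n = 0 then (m : ℂ) ^ 3 - m else 0) • c :=
  bracketHom_basis _ _

@[simp] theorem bracketHom_T_l (m n : ℤ) : bracketHom (T m) (l n) =
    -(((n : ℂ) - m) • T (n + m) + (if n + m = 0 then (n : ℂ) ^ 3 - n else 0) • c) :=
  bracketHom_basis _ _

@[simp] theorem bracketHom_T_T (m n : ℤ) : bracketHom (T m) (T n) = 0 := bracketHom_basis _ _

@[simp] theorem bracketHom_c_left (x : BMS3c) : bracketHom c x = 0 := by
  have : bracketHom c = 0 := basis.ext fun j => by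
    cases j <;> exact bracketHom_basis _ _
  simp [this]

theorem bracketHom_skew (x y : BMS3c) : bracketHom x y = -bracketHom y x := by
  have : bracketHom = -bracketHom.flip := by
    refine basis.ext fun i => basis.ext fun j => ?_
    simp only [LinearMap.neg_apply, LinearMap.flip_apply, bracketHom_basis]
    rcases i with m | m | _ <;> rcases j with n | n | _ <;> simp [basisBracket]
    rw [← neg_smul, neg_sub, add_comm n m]
  exact LinearMap.congr_fun₂ this x y

@[simp] theorem bracketHom_c_right (x : BMS3c) : bracketHom x c = 0 := by
  rw [bracketHom_skew, bracketHom_c_left, neg_zero]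

theorem bracketHom_self (x : BMS3c) : bracketHom x x = 0 := by
  have h : (2 : ℂ) • bracketHom x x = 0 := by
    rw [two_smul]
    nth_rewrite 1 [bracketHom_skew]
    exact neg_add_cancel _
  exact (smul_eq_zero.mp h).resolve_left two_ne_zero

theorem bracketHom_jacobi (x y z : BMS3c) :
    bracketHom x (bracketHom y z) =
      bracketHom (bracketHom x y) z + bracketHom y (bracketHom x z) := by
  have key : ∀ i j k : BMSIndex, bracketHom (basis i) (bracketHom (basis j) (basis k)) =
      bracketHom (bracketHom (basis i) (basis j)) (basis k) +
        bracketHom (basis j) (bracketHom (basis i) (basis k)) := by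
    have hl (m : ℤ) : basis (.l m) = l m := rfl
    have hT (m : ℤ) : basis (.T m) = T m := rfl
    have hc : basis .c = c := rfl
    rintro (m | m | _) (n | n | _) (k | k | _) <;>
      simp only [hl, hT, hc, bracketHom_l_l, bracketHom_l_T, bracketHom_T_l, bracketHom_T_T,
        bracketHom_c_left, bracketHom_c_right, map_add, map_neg, map_smul, map_zero,
        LinearMap.add_apply, LinearMap.neg_apply, LinearMap.smul_apply, LinearMap.zero_apply,
        smul_zero, neg_zero, add_zero]
    all_goals
      have e1 : m + (n + k) = m + n + k := by ring
      have e2 : n + (m + k) = m + n + k := by ring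
      have e3 : k + (m + n) = m + n + k := by ring
      have e4 : m + (k + n) = m + n + k := by ring
      have e5 : m + k + n = m + n + k := by ring
      have e6 : n + k + m = m + n + k := by ring
      have e7 : k + (n + m) = m + n + k := by ring
      have e8 : n + (k + m) = m + n + k := by ring
      simp only [e1, e2, e3, e4, e5, e6, e7, e8]
      push_cast
      by_cases h : m + n + k = 0
      · obtain rfl : k = -m - n := by linarith
        push_cast
        simp only [h, if_true]
        module
      · try simp only [if_neg h, zero_smul]
        module
  have h1 (i j : BMSIndex) (z : BMS3c) : bracketHom (basis i) (bracketHom (basis j) z) =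
      bracketHom (bracketHom (basis i) (basis j)) z +
        bracketHom (basis j) (bracketHom (basis i) z) := by
    have : bracketHom (basis i) ∘ₗ bracketHom (basis j) =
        bracketHom (bracketHom (basis i) (basis j)) +
          bracketHom (basis j) ∘ₗ bracketHom (basis i) :=
      basis.ext fun k => key i j k
    exact LinearMap.congr_fun this z
  have h2 (i : BMSIndex) (y z : BMS3c) : bracketHom (basis i) (bracketHom y z) =
      bracketHom (bracketHom (basis i) y) z + bracketHom y (bracketHom (basis i) z) := by
    have : bracketHom (basis i) ∘ₗ bracketHom.flip z =
        bracketHom.flip z ∘ₗ bracketHom (basis i) +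
          bracketHom.flip (bracketHom (basis i) z) :=
      basis.ext fun j => h1 i j z
    exact LinearMap.congr_fun this y
  have h3 : bracketHom.flip (bracketHom y z) =
      bracketHom.flip z ∘ₗ bracketHom.flip y + bracketHom y ∘ₗ bracketHom.flip z :=
    basis.ext fun i => h2 i y z
  exact LinearMap.congr_fun h3 x

noncomputable instance : LieRing BMS3c where
  bracket x y := bracketHom x y
  add_lie x y z := by simp
  lie_add x y z := by simp
  lie_self := bracketHom_self
  leibniz_lie := bracketHom_jacobi

noncomputable instance : LieAlgebra ℂ BMS3c where
  lie_smul a x y := map_smul (bracketHom x) a y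

theorem lie_l_l (m n : ℤ) : ⁅l m, l n⁆ = ((m : ℂ) - n) • l (m + n) := bracketHom_l_l m n

theorem lie_l_T (m n : ℤ) : ⁅l m, T n⁆ =
    ((m : ℂ) - n) • T (m + n) + (if m + n = 0 then (m : ℂ) ^ 3 - m else 0) • c :=
  bracketHom_l_T m n

theorem lie_T_T (m n : ℤ) : ⁅T m, T n⁆ = 0 := bracketHom_T_T m n

theorem lie_c (x : BMS3c) : ⁅x, c⁆ = 0 := bracketHom_c_right x

/-- The linear map `δ_α` with `l_m ↦ 0`, `T_m ↦ α c ∧ T_m` and `c ↦ 0`. -/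
noncomputable def delta (α : ℂ) : BMS3c →ₗ[ℂ] ExteriorSquare ℂ BMS3c :=
  basis.constr ℂ fun i =>
    match i with
    | .l _ => 0
    | .T m => α • wedge ℂ c (T m)
    | .c => 0

theorem delta_l (α : ℂ) (m : ℤ) : delta α (l m) = 0 := basis.constr_basis ℂ _ _

theorem delta_T (α : ℂ) (m : ℤ) : delta α (T m) = α • wedge ℂ c (T m) := basis.constr_basis ℂ _ _

theorem delta_c (α : ℂ) : delta α c = 0 := basis.constr_basis ℂ _ _

end BMS3c

/-! ### Finitely supported functions on `ℤ` -/

/-! The `l m` span a copy `W` of the Witt algebra, without central term. Let `A` be its adjoint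
module. As a `W`-module, the algebra modulo `c` is `A ⊕ A`, one copy for the `l m` and one for the
`T m`. Hence `c ∧ -` gives a submodule `A ⊕ A` of the exterior square, and the quotient by it embeds
by antisymmetrization into a sum of four copies of `A ⊗ A`. Everything follows from facts about `A`
and `A ⊗ A`, proved in coordinates for finitely supported coefficients.

Existence: `H¹(W, A) = 0` (`exists_eq_of_adjoint_cocycle`) and `H¹(W, A ⊗ A) = 0`
(`exists_eq_of_tensor_cocycle`), so every cocycle becomes zero on `W` after subtracting a coboundary
(`exists_eq_lie_l`). It then maps `c` to a `W`-invariant, which is zero, and is `W`-equivariant on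
the `T n`. Since `Hom_W(A, A ⊗ A) = 0` (`eq_zero_of_tensor_hom`) and `Hom_W(A, A) = ℂ`
(`eq_of_adjoint_hom`), it sends `T n` to `β c ∧ T n + γ c ∧ l n`. The relation `[T 1, T 0] = 0`
forces `γ = 0` (`exists_eq_delta`).

Uniqueness: `A` and `A ⊗ A` have no invariants, so a coboundary that vanishes on `W` comes from `r =
0`.

The hard point is `H¹(W, A ⊗ A) = 0`. Correcting by means of `l 0` leaves a cocycle of weight zero.
It is normalized at `l 1`, and the relations among `l 1`, `l (-1)`, `l 2`, `l (-2)` then leave one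
free parameter, accounted for by the `sl₂`-invariant `l (-1) ⊗ l 1 - 2 l 0 ⊗ l 0 + l 1 ⊗ l (-1)`. -/

theorem exists_bound_of_finite_support {f : ℤ → ℂ} (hf : f.support.Finite) :
    ∃ N : ℤ, 0 ≤ N ∧ ∀ p, N < |p| → f p = 0 := by
  obtain ⟨N, hN⟩ := (hf.image fun p => |p|).bddAbove
  refine ⟨max N 0, le_max_right _ _, fun p hp => ?_⟩
  by_contra h
  have := hN ⟨p, h, rfl⟩
  have := le_max_left N 0
  simp only at *
  omega

theorem exists_bound_of_finite_support_prod {f : ℤ × ℤ → ℂ} (hf : f.support.Finite) :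
    ∃ N : ℤ, 0 ≤ N ∧ ∀ p q, N < |p| ∨ N < |q| → f (p, q) = 0 := by
  obtain ⟨N, hN⟩ := (hf.image fun x => max |x.1| |x.2|).bddAbove
  refine ⟨max N 0, le_max_right _ _, fun p q hp => ?_⟩
  by_contra h
  have := hN ⟨(p, q), h, rfl⟩
  have := le_max_left N 0
  have := le_max_left |p| |q|
  have := le_max_right |p| |q|
  simp only at *
  omega

/-- Finite support starts the recursion far to the right; it then runs down to `K`. -/
theorem eq_zero_of_descending {f : ℤ → ℂ} (hf : f.support.Finite) (K : ℤ)
    (h : ∀ p, K ≤ p → f (p + 1) = 0 → f p = 0) (p : ℤ) (hp : K ≤ p) : f p = 0 := by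
  obtain ⟨N, -, hN⟩ := exists_bound_of_finite_support hf
  have key : ∀ k : ℕ, ∀ p, K ≤ p → N < p + k → f p = 0 := by
    intro k
    induction k with
    | zero => exact fun p _ h2 => hN p (lt_of_lt_of_le (by simpa using h2) (le_abs_self p))
    | succ k ih =>
      intro p h1 h2
      exact h p h1 (ih (p + 1) (by omega) (by push_cast at h2; omega))
  exact key (N - p + 1).toNat p hp (by omega)

theorem eq_zero_of_ascending {f : ℤ → ℂ} (hf : f.support.Finite) (K : ℤ)
    (h : ∀ p, p ≤ K → f (p - 1) = 0 → f p = 0) (p : ℤ) (hp : p ≤ K) : f p = 0 := by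
  have hf' : (fun p => f (-p)).support.Finite := hf.preimage neg_injective.injOn
  have := eq_zero_of_descending hf' (-K)
    (fun p hp hz => h (-p) (by omega) (by rwa [neg_add] at hz)) (-p) (by omega)
  simpa using this

/-! ### The adjoint module of the Witt algebra -/

/-- A finitely supported 1-cocycle of the Witt algebra with values in the adjoint module is
inner. -/
theorem exists_eq_of_adjoint_cocycle {E : ℤ → ℤ → ℂ} (hfin : (E 0).support.Finite)
    (h : ∀ m n q : ℤ, ((m : ℂ) - n) * E (m + n) q =
      (2 * m - q) * E n (q - m) - (2 * n - q) * E m (q - n)) :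
    ∃ s : ℤ → ℂ, s.support.Finite ∧ ∀ m q : ℤ, E m q = (2 * m - q) * s (q - m) := by
  have h00 : E 0 0 = 0 := by
    have := h 1 0 1
    norm_num at this
    exact this
  -- The diagonal coefficients form the weight-zero part of the cocycle. They are additive, but only
  -- for distinct indices, because of the factor `m - n`.
  have hg : ∀ m n : ℤ, m ≠ n → E (m + n) (m + n) = E m m + E n n := by
    intro m n hmn
    have hmn' : (m : ℂ) - n ≠ 0 := by exact_mod_cast sub_ne_zero.mpr hmn
    have := h m n (m + n)
    simp only [add_sub_cancel_left, add_sub_cancel_right] at this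
    push_cast at this
    apply mul_left_cancel₀ hmn'
    linear_combination this
  -- The excluded case `1 + 1` is recovered by comparing `5 = 4 + 1` with `5 = 3 + 2`.
  have h2 : E 2 2 = 2 * E 1 1 := by
    have a3 := hg 2 1 (by norm_num)
    have a4 := hg 3 1 (by norm_num)
    have a5 := hg 4 1 (by norm_num)
    have b5 := hg 3 2 (by norm_num)
    norm_num at a3 a4 a5 b5
    linear_combination a5 + a4 - b5
  have hstep : ∀ n : ℤ, E (n + 1) (n + 1) = E n n + E 1 1 := by
    intro n
    by_cases hn : n = 1
    · subst hn
      norm_num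
      linear_combination h2
    · exact hg n 1 hn
  have hlin : ∀ n : ℤ, E n n = n * E 1 1 := by
    intro n
    induction n with
    | zero => simpa using h00
    | succ k ih => rw [hstep, ih]; push_cast; ring
    | pred k ih =>
      have := hstep (-(k : ℤ) - 1)
      rw [sub_add_cancel, ih] at this
      push_cast at this ⊢
      linear_combination -this
  -- In weight `q ≠ 0` the operator `l 0` acts by `-q` and can be inverted. In weight zero, `E n n =
  -- n * E 1 1` is the coboundary of a multiple of `l 0`.
  refine ⟨fun q => if q = 0 then E 1 1 else -E 0 q / q, ?_, fun m q => ?_⟩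
  · refine (hfin.union (Set.finite_singleton 0)).subset fun q hq => ?_
    by_cases h0 : q = 0
    · exact Or.inr h0
    · refine Or.inl fun h' => hq ?_
      simp [h0, h']
  · by_cases hqm : q - m = 0
    · obtain rfl : q = m := by omega
      rw [hlin]
      simp only [sub_self, if_true]
      ring
    · have e := h m 0 q
      have hqm' : (q : ℂ) - m ≠ 0 := by exact_mod_cast hqm
      simp only [if_neg hqm]
      simp only [add_zero, sub_zero, Int.cast_zero] at e
      push_cast
      field_simp
      linear_combination -e

/-- An equivariant endomorphism of the adjoint module of the Witt algebra is a scalar. -/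
theorem eq_of_adjoint_hom {F : ℤ → ℤ → ℂ}
    (h : ∀ m n q : ℤ, ((m : ℂ) - n) * F (m + n) q = (2 * m - q) * F n (q - m)) (n q : ℤ) :
    F n q = if q = n then F 0 0 else 0 := by
  split_ifs with hq
  · subst hq
    by_cases h0 : q = 0
    · rw [h0]
    · have e := h q 0 q
      have h0' : (q : ℂ) ≠ 0 := by exact_mod_cast h0
      simp only [add_zero, sub_self, Int.cast_zero] at e
      exact mul_left_cancel₀ h0' (by linear_combination e)
  · have e := h 0 n q
    have hq' : (q : ℂ) - n ≠ 0 := by exact_mod_cast sub_ne_zero.mpr hq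
    simp only [zero_add, sub_zero, Int.cast_zero] at e
    exact mul_left_cancel₀ hq' (by linear_combination e)

theorem eq_zero_of_adjoint_invariant {s : ℤ → ℂ}
    (h : ∀ m q : ℤ, (2 * (m : ℂ) - q) * s (q - m) = 0) (q : ℤ) : s q = 0 := by
  -- This choice makes the factor `2 * m - q` equal to `1`.
  have := h (q + 1) (q + (q + 1))
  rw [add_sub_cancel_right] at this
  push_cast at this
  linear_combination this

/-! ### The tensor square of the adjoint module of the Witt algebra -/

theorem eq_zero_of_tensor_invariant {f : ℤ × ℤ → ℂ} (hf : f.support.Finite)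
    (h : ∀ m p q : ℤ, (2 * (m : ℂ) - p) * f (p - m, q) + (2 * m - q) * f (p, q - m) = 0)
    (p q : ℤ) : f (p, q) = 0 := by
  obtain ⟨N, hN0, hN⟩ := exists_bound_of_finite_support_prod hf
  -- Acting by `l m` with `m` large pushes the other term out of the support.
  obtain ⟨m, hm⟩ : ∃ m : ℤ, m = N + |p| + 1 := ⟨_, rfl⟩
  have h1 := neg_abs_le p
  have h2 := le_abs_self p
  have hz : f (p + m, q - m) = 0 := hN _ _ (Or.inl (lt_of_lt_of_le (by omega) (le_abs_self _)))
  have hmp : (m : ℂ) - p ≠ 0 := by exact_mod_cast (by omega : m - p ≠ 0)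
  have := h m (p + m) q
  rw [add_sub_cancel_right, hz] at this
  push_cast at this
  exact mul_left_cancel₀ hmp (by linear_combination this)

/-- Equivariance gives `m F m = l m · F 0`, so `F 0` determines every other value and must itself
satisfy a quadratic relation (`key`). Finite support makes that relation overdetermined. -/
theorem tensor_hom_at_zero_eq_zero {F : ℤ → ℤ × ℤ → ℂ} (hf : (F 0).support.Finite)
    (h : ∀ m n p q : ℤ, ((m : ℂ) - n) * F (m + n) (p, q) =
      (2 * m - p) * F n (p - m, q) + (2 * m - q) * F n (p, q - m)) : F 0 = 0 := by
  have h0 (m p q : ℤ) : (m : ℂ) * F m (p, q) =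
      (2 * m - p) * F 0 (p - m, q) + (2 * m - q) * F 0 (p, q - m) := by
    simpa using h m 0 p q
  generalize F 0 = f at hf h0
  -- This is `n (m - n) l (m + n) · f = (m + n) l m · (l n · f)` at the coefficient `(P, Q)`.
  have key (m n P Q : ℤ) : (n : ℂ) * (m - n) * ((2 * (m + n) - P) * f (P - (m + n), Q)
      + (2 * (m + n) - Q) * f (P, Q - (m + n))) =
      (m + n) * ((2 * m - P) * ((2 * n - P + m) * f (P - (m + n), Q)
          + (2 * n - Q) * f (P - m, Q - n))
        + (2 * m - Q) * ((2 * n - P) * f (P - n, Q - m)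
          + (2 * n - Q + m) * f (P, Q - (m + n)))) := by
    have e1 := h0 (m + n) P Q
    have e2 := h0 n (P - m) Q
    have e3 := h0 n P (Q - m)
    have e4 := h m n P Q
    rw [sub_sub] at e2 e3
    push_cast at e1 e2 e3
    linear_combination (-(n : ℂ) * (m - n)) * e1 + ((m : ℂ) + n) * (2 * m - P) * e2
      + ((m : ℂ) + n) * (2 * m - Q) * e3 + (n : ℂ) * (m + n) * e4
  obtain ⟨N, hN0, hN⟩ := exists_bound_of_finite_support_prod hf
  have hp (p q : ℤ) (hp0 : p ≠ 0) : f (p, q) = 0 := by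
    obtain ⟨n, hn⟩ : ∃ n : ℤ, n = N + |p| + 1 := ⟨_, rfl⟩
    have h1 := neg_abs_le p
    have h2 := le_abs_self p
    have z (k j : ℤ) (hk : n ≤ k) : f (p + k, j) = 0 :=
      hN _ _ (Or.inl (lt_of_lt_of_le (by omega) (le_abs_self _)))
    -- For large `n` only the terms in `f (p, q)` survive, with total coefficient `n² (3n - p) - 3n
    -- (n - p)² = p n (5n - 3p)`.
    have e := key (2 * n) n (p + (2 * n + n)) q
    rw [add_sub_cancel_right, z _ _ (by omega),
      show p + (2 * n + n) - 2 * n = p + n by ring, z n _ le_rfl,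
      show p + (2 * n + n) - n = p + 2 * n by ring, z (2 * n) _ (by omega)] at e
    push_cast at e
    have hne : (p : ℂ) * (n * (5 * n - 3 * p)) ≠ 0 := by
      have : p * (n * (5 * n - 3 * p)) ≠ 0 :=
        mul_ne_zero hp0 (mul_ne_zero (by omega) (by omega))
      exact_mod_cast this
    exact mul_left_cancel₀ hne (by linear_combination e)
  have hq (p q : ℤ) (hq0 : q ≠ 0) : f (p, q) = 0 := by
    obtain ⟨n, hn⟩ : ∃ n : ℤ, n = N + |q| + 1 := ⟨_, rfl⟩
    have h1 := neg_abs_le q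
    have h2 := le_abs_self q
    have z (k j : ℤ) (hk : n ≤ k) : f (j, q + k) = 0 :=
      hN _ _ (Or.inr (lt_of_lt_of_le (by omega) (le_abs_self _)))
    have e := key (2 * n) n p (q + (2 * n + n))
    rw [add_sub_cancel_right, z _ _ (by omega),
      show q + (2 * n + n) - 2 * n = q + n by ring, z n _ le_rfl,
      show q + (2 * n + n) - n = q + 2 * n by ring, z (2 * n) _ (by omega)] at e
    push_cast at e
    have hne : (q : ℂ) * (n * (5 * n - 3 * q)) ≠ 0 := by
      have : q * (n * (5 * n - 3 * q)) ≠ 0 :=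
        mul_ne_zero hq0 (mul_ne_zero (by omega) (by omega))
      exact_mod_cast this
    exact mul_left_cancel₀ hne (by linear_combination e)
  have h00 : f (0, 0) = 0 := by
    -- Here `f (0, 0)` occurs once, with coefficient `6`, and every other term has a nonzero first
    -- index.
    have e := key 2 1 2 1
    norm_num [hp] at e
    exact e
  funext ⟨p, q⟩
  by_cases hp0 : p = 0
  · by_cases hq0 : q = 0
    · rw [hp0, hq0, h00]; rfl
    · exact hq p q hq0
  · exact hp p q hp0

/-- There is no nonzero equivariant map from the adjoint module of the Witt algebra to its tensor
square. -/
theorem eq_zero_of_tensor_hom {F : ℤ → ℤ × ℤ → ℂ} (hf : (F 0).support.Finite)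
    (h : ∀ m n p q : ℤ, ((m : ℂ) - n) * F (m + n) (p, q) =
      (2 * m - p) * F n (p - m, q) + (2 * m - q) * F n (p, q - m)) (n p q : ℤ) :
    F n (p, q) = 0 := by
  have hF0 := tensor_hom_at_zero_eq_zero hf h
  by_cases hn : n = 0
  · rw [hn, hF0]; rfl
  · have e := h n 0 p q
    have hn' : (n : ℂ) ≠ 0 := by exact_mod_cast hn
    rw [add_zero, hF0] at e
    simp at e
    tauto

/-! ### Weight-zero cocycles with values in the tensor square -/

/-- A weight-zero 1-cocycle of the Witt algebra with values in the tensor square of its adjoint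
module, written in coordinates: `d m p` is the coefficient of `l_p ⊗ l_{m-p}` in the value at
`l_m`. -/
def IsDiagonalCocycle (d : ℤ → ℤ → ℂ) : Prop :=
  ∀ m n p : ℤ, ((m : ℂ) - n) * d (m + n) p =
    (2 * m - p) * d n (p - m) + (m - n + p) * d n p
      - (2 * n - p) * d m (p - n) - (n - m + p) * d m p

/-- The inner weight-zero cocycle given by `∑ r p • l_p ⊗ l_{-p}`. -/
def diagonalCoboundary (r : ℤ → ℂ) (m p : ℤ) : ℂ := (2 * m - p) * r (p - m) + (m + p) * r p

theorem isDiagonalCocycle_diagonalCoboundary (r : ℤ → ℂ) :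
    IsDiagonalCocycle (diagonalCoboundary r) := by
  intro m n p
  simp only [diagonalCoboundary]
  rw [show p - m - n = p - (m + n) by ring, show p - n - m = p - (m + n) by ring]
  push_cast
  ring

theorem IsDiagonalCocycle.sub {d e : ℤ → ℤ → ℂ} (hd : IsDiagonalCocycle d)
    (he : IsDiagonalCocycle e) : IsDiagonalCocycle (d - e) := by
  intro m n p
  simp only [Pi.sub_apply]
  linear_combination hd m n p - he m n p

theorem finite_support_diagonalCoboundary {r : ℤ → ℂ} (hr : r.support.Finite) (m : ℤ) :
    (diagonalCoboundary r m).support.Finite := by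
  refine ((hr.preimage (sub_left_injective (b := m)).injOn).union hr).subset fun p hp => ?_
  by_contra hc
  simp only [Set.mem_union, Set.mem_preimage, Function.mem_support, not_or, not_not] at hc
  exact hp (by simp [diagonalCoboundary, hc])

theorem diagonalCoboundary_add (r s : ℤ → ℂ) :
    diagonalCoboundary (r + s) = diagonalCoboundary r + diagonalCoboundary s := by
  funext m p
  simp only [diagonalCoboundary, Pi.add_apply]
  ring

/-- The image of `l_1` in weight one is complementary to the span of `l_{-1} ⊗ l_2` and
`l_2 ⊗ l_{-1}`. -/
theorem exists_diagonalCoboundary_one_eq (a : ℤ →₀ ℂ) : ∃ r : ℤ →₀ ℂ, ∀ p : ℤ, p ≠ -1 → p ≠ 2 →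
    a p = diagonalCoboundary r 1 p := by
  have hadd : ∀ a b : ℤ →₀ ℂ,
      (∃ r : ℤ →₀ ℂ, ∀ p : ℤ, p ≠ -1 → p ≠ 2 → a p = diagonalCoboundary r 1 p) →
      (∃ r : ℤ →₀ ℂ, ∀ p : ℤ, p ≠ -1 → p ≠ 2 → b p = diagonalCoboundary r 1 p) →
      ∃ r : ℤ →₀ ℂ, ∀ p : ℤ, p ≠ -1 → p ≠ 2 → (a + b) p = diagonalCoboundary r 1 p := by
    rintro a b ⟨r, hr⟩ ⟨s, hs⟩
    refine ⟨r + s, fun p h1 h2 => ?_⟩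
    rw [Finsupp.coe_add, Finsupp.coe_add, diagonalCoboundary_add, Pi.add_apply, hr p h1 h2,
      hs p h1 h2]
    rfl
  have hsmul : ∀ (c : ℂ) (a : ℤ →₀ ℂ),
      (∃ r : ℤ →₀ ℂ, ∀ p : ℤ, p ≠ -1 → p ≠ 2 → a p = diagonalCoboundary r 1 p) →
      ∃ r : ℤ →₀ ℂ, ∀ p : ℤ, p ≠ -1 → p ≠ 2 → (c • a) p = diagonalCoboundary r 1 p := by
    rintro c a ⟨r, hr⟩
    refine ⟨c • r, fun p h1 h2 => ?_⟩
    simp only [Finsupp.smul_apply, smul_eq_mul, hr p h1 h2, diagonalCoboundary]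
    ring
  -- Two neighbouring basis vectors are linked by the image of `l k ⊗ l (-k)`. The link breaks
  -- upwards at `k = 1` and downwards at `k = -1`, so the chains start at `-1` and `2`.
  have himg : ∀ k p : ℤ, diagonalCoboundary (Finsupp.single k (1 : ℂ)) 1 p =
      (1 - k) * Finsupp.single (k + 1) (1 : ℂ) p + (1 + k) * Finsupp.single k (1 : ℂ) p := by
    intro k p
    simp only [diagonalCoboundary, Finsupp.single_apply]
    rcases eq_or_ne k p with rfl | h1
    · rw [if_neg (by omega), if_pos rfl, if_neg (by omega)]
      push_cast
      ring
    · rcases eq_or_ne (k + 1) p with rfl | h2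
      · simp
        ring
      · rw [if_neg h1, if_neg h2, if_neg (by omega)]
        ring
  have hup : ∀ k : ℤ, k ≠ 1 →
      (∃ r : ℤ →₀ ℂ, ∀ p : ℤ, p ≠ -1 → p ≠ 2 → Finsupp.single k 1 p = diagonalCoboundary r 1 p) →
      ∃ r : ℤ →₀ ℂ, ∀ p : ℤ, p ≠ -1 → p ≠ 2 →
        Finsupp.single (k + 1) 1 p = diagonalCoboundary r 1 p := by
    intro k hk hP
    have hk' : (1 : ℂ) - k ≠ 0 := by exact_mod_cast (by omega : 1 - k ≠ 0)
    have e : Finsupp.single (k + 1) (1 : ℂ) = (1 - (k : ℂ))⁻¹ •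
        (((1 - k : ℂ) • Finsupp.single (k + 1) (1 : ℂ) + (1 + k : ℂ) • Finsupp.single k (1 : ℂ))
          + (-(1 + k : ℂ)) • Finsupp.single k (1 : ℂ)) := by
      rw [neg_smul, add_neg_cancel_right, inv_smul_smul₀ hk']
    rw [e]
    exact hsmul _ _ (hadd _ _ ⟨Finsupp.single k 1, fun p _ _ => (himg k p).symm⟩ (hsmul _ _ hP))
  have hdown : ∀ k : ℤ, k ≠ -1 →
      (∃ r : ℤ →₀ ℂ, ∀ p : ℤ, p ≠ -1 → p ≠ 2 →
        Finsupp.single (k + 1) 1 p = diagonalCoboundary r 1 p) →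
      ∃ r : ℤ →₀ ℂ, ∀ p : ℤ, p ≠ -1 → p ≠ 2 →
        Finsupp.single k 1 p = diagonalCoboundary r 1 p := by
    intro k hk hP
    have hk' : (1 : ℂ) + k ≠ 0 := by exact_mod_cast (by omega : 1 + k ≠ 0)
    have e : Finsupp.single k (1 : ℂ) = (1 + (k : ℂ))⁻¹ •
        (((1 - k : ℂ) • Finsupp.single (k + 1) (1 : ℂ) + (1 + k : ℂ) • Finsupp.single k (1 : ℂ))
          + (-(1 - k : ℂ)) • Finsupp.single (k + 1) (1 : ℂ)) := by
      rw [neg_smul, add_comm (_ • _) ((1 + k : ℂ) • _), add_neg_cancel_right, inv_smul_smul₀ hk']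
    rw [e]
    exact hsmul _ _ (hadd _ _ ⟨Finsupp.single k 1, fun p _ _ => (himg k p).symm⟩ (hsmul _ _ hP))
  have hsingle : ∀ k : ℤ, ∃ r : ℤ →₀ ℂ, ∀ p : ℤ, p ≠ -1 → p ≠ 2 →
      Finsupp.single k 1 p = diagonalCoboundary r 1 p := by
    have h2 : ∃ r : ℤ →₀ ℂ, ∀ p : ℤ, p ≠ -1 → p ≠ 2 →
        Finsupp.single 2 1 p = diagonalCoboundary r 1 p :=
      ⟨0, fun p _ h2 => by simp [diagonalCoboundary, Ne.symm h2]⟩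
    have h1 : ∃ r : ℤ →₀ ℂ, ∀ p : ℤ, p ≠ -1 → p ≠ 2 →
        Finsupp.single (-1) 1 p = diagonalCoboundary r 1 p :=
      ⟨0, fun p h1 _ => by simp [diagonalCoboundary, Ne.symm h1]⟩
    have h0 : ∃ r : ℤ →₀ ℂ, ∀ p : ℤ, p ≠ -1 → p ≠ 2 →
        Finsupp.single 0 1 p = diagonalCoboundary r 1 p := hup (-1) (by norm_num) h1
    intro k
    rcases le_or_gt 2 k with hk | hk
    · induction k, hk using Int.leInduction with
      | base => exact h2
      | succ k hk ih => exact hup k (by omega) ih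
    · rcases le_or_gt k (-1) with hk' | hk'
      · clear hk
        induction k, hk' using Int.leInductionDown with
        | base => exact h1
        | pred k hk ih => exact hdown (k - 1) (by omega) (by rwa [sub_add_cancel])
      · obtain rfl | rfl : k = 0 ∨ k = 1 := by omega
        · exact h0
        · exact hup 0 (by norm_num) h0
  induction a using Finsupp.induction_linear with
  | zero => exact ⟨0, fun p _ _ => by simp [diagonalCoboundary]⟩
  | add a b ha hb => exact hadd a b ha hb
  | single k c =>
    have := hsmul c _ (hsingle k)
    rwa [Finsupp.smul_single, smul_eq_mul, mul_one] at this

/-- A weight-zero cocycle vanishing at `l_1`, `l_{-1}`, `l_2`, `l_{-2}` vanishes. -/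
theorem IsDiagonalCocycle.eq_zero {d : ℤ → ℤ → ℂ} (hd : IsDiagonalCocycle d) (h0 : d 0 = 0)
    (h1 : d 1 = 0) (h2 : d 2 = 0) (h1' : d (-1) = 0) (h2' : d (-2) = 0) (m : ℤ) : d m = 0 := by
  -- The kernel is closed under brackets, and `l 1`, `l 2`, `l (-1)`, `l (-2)` generate the Witt
  -- algebra.
  have key : ∀ m n : ℤ, m ≠ n → d m = 0 → d n = 0 → d (m + n) = 0 := by
    intro m n hmn hm hn
    have hmn' : (m : ℂ) - n ≠ 0 := by exact_mod_cast sub_ne_zero.mpr hmn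
    funext p
    have := hd m n p
    rw [hm, hn] at this
    exact mul_left_cancel₀ hmn' (by simpa using this)
  rcases le_or_gt 2 m with hm | hm
  · induction m, hm using Int.leInduction with
    | base => exact h2
    | succ k hk ih => exact key k 1 (by omega) ih h1
  · rcases le_or_gt m (-2) with hm' | hm'
    · clear hm
      induction m, hm' using Int.leInductionDown with
      | base => exact h2'
      | pred k hk ih => exact key k (-1) (by omega) ih h1'
    · obtain rfl | rfl | rfl : m = -1 ∨ m = 0 ∨ m = 1 := by omega
      exacts [h1', h0, h1]

/-- A weight-zero cocycle whose value at `l_1` lies in the span of `l_{-1} ⊗ l_2` and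
`l_2 ⊗ l_{-1}` is a multiple of the coboundary of the invariant of `sl₂`. -/
theorem IsDiagonalCocycle.exists_eq_of_normalized {d : ℤ → ℤ → ℂ} (hd : IsDiagonalCocycle d)
    (hfin : ∀ m, (d m).support.Finite) (h0 : d 0 = 0)
    (h1 : ∀ p : ℤ, p ≠ -1 → p ≠ 2 → d 1 p = 0) :
    ∃ r : ℤ → ℂ, r.support.Finite ∧ d = diagonalCoboundary r := by
  have r1 (p : ℤ) := hd 1 (-1) p
  have r2 (p : ℤ) := hd (-1) 2 p
  have r3 (p : ℤ) := hd 1 (-2) p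
  have r4 (p : ℤ) := hd 2 (-2) p
  norm_num [h0] at r1 r2 r3 r4
  -- Away from `-1` and `2` the relations are two-term recursions, so finite support confines `d
  -- (-1)` to `[-2, 1]`, `d 2` to `[-1, 3]` and `d (-2)` to `[-3, 1]`.
  have u1 (p : ℤ) (hp : 2 ≤ p) : d (-1) p = 0 := by
    refine eq_zero_of_descending (hfin _) 2 (fun p hp hz => ?_) p hp
    have e := r1 (p + 1)
    rw [add_sub_cancel_right, hz, h1 _ (by omega) (by omega), h1 _ (by omega) (by omega)] at e
    have hne : (1 : ℂ) - p ≠ 0 := by exact_mod_cast (by omega : 1 - p ≠ 0)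
    push_cast at e
    exact mul_left_cancel₀ hne (by linear_combination -e)
  have v1 (p : ℤ) (hp : p ≤ -3) : d (-1) p = 0 := by
    refine eq_zero_of_ascending (hfin _) (-3) (fun p hp hz => ?_) p hp
    have e := r1 p
    rw [hz, h1 _ (by omega) (by omega), h1 _ (by omega) (by omega)] at e
    have hne : (2 : ℂ) + p ≠ 0 := by exact_mod_cast (by omega : 2 + p ≠ 0)
    exact mul_left_cancel₀ hne (by linear_combination -e)
  have u2 (p : ℤ) (hp : 4 ≤ p) : d 2 p = 0 := by
    refine eq_zero_of_descending (hfin _) 4 (fun p hp hz => ?_) p hp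
    have e := r2 p
    rw [hz, h1 _ (by omega) (by omega), u1 _ (by omega), u1 _ (by omega)] at e
    have hne : (3 : ℂ) - p ≠ 0 := by exact_mod_cast (by omega : 3 - p ≠ 0)
    exact mul_left_cancel₀ hne (by linear_combination e)
  have v2 (p : ℤ) (hp : p ≤ -2) : d 2 p = 0 := by
    refine eq_zero_of_ascending (hfin _) (-2) (fun p hp hz => ?_) p hp
    have e := r2 (p - 1)
    rw [sub_add_cancel, hz, h1 _ (by omega) (by omega), v1 _ (by omega), v1 _ (by omega)] at e
    have hne : (1 : ℂ) + p ≠ 0 := by exact_mod_cast (by omega : 1 + p ≠ 0)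
    push_cast at e
    exact mul_left_cancel₀ hne (by linear_combination e)
  have u3 (p : ℤ) (hp : 2 ≤ p) : d (-2) p = 0 := by
    refine eq_zero_of_descending (hfin _) 2 (fun p hp hz => ?_) p hp
    have e := r3 (p + 1)
    rw [add_sub_cancel_right, hz, h1 _ (by omega) (by omega), h1 _ (by omega) (by omega),
      u1 _ (by omega)] at e
    have hne : (1 : ℂ) - p ≠ 0 := by exact_mod_cast (by omega : 1 - p ≠ 0)
    push_cast at e
    exact mul_left_cancel₀ hne (by linear_combination -e)
  have v3 (p : ℤ) (hp : p ≤ -4) : d (-2) p = 0 := by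
    refine eq_zero_of_ascending (hfin _) (-4) (fun p hp hz => ?_) p hp
    have e := r3 p
    rw [hz, h1 _ (by omega) (by omega), h1 _ (by omega) (by omega), v1 _ (by omega)] at e
    have hne : (3 : ℂ) + p ≠ 0 := by exact_mod_cast (by omega : 3 + p ≠ 0)
    exact mul_left_cancel₀ hne (by linear_combination -e)
  -- At these ends of the windows the only unknown from `d 2` or `d (-2)` has coefficient zero, so
  -- each relation isolates one unknown.
  have w : d (-1) (-2) = 0 ∧ d (-1) 1 = 0 ∧ d 1 (-1) = 0 ∧ d 1 2 = 0 := by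
    have a1 := r2 (-2)
    have a2 := r2 3
    have a3 := r3 (-3)
    have a4 := r3 2
    norm_num [h1, u1, v1, u2, v2, u3, v3] at a1 a2 a3 a4
    exact ⟨a1, a2, a3.symm, a4.symm⟩
  obtain ⟨w1, w2, w3, w4⟩ := w
  have w5 : d (-1) (-1) = 0 := by
    have a := r1 (-1)
    norm_num [h1, w1, w3] at a
    exact a.symm
  have w6 : d (-1) 0 = 0 := by
    have a := r1 1
    norm_num [h1, w2, w4] at a
    exact a.symm
  -- Now `d 1` and `d (-1)` vanish. The relations give `d 2` the coefficients `1, -4, 6, -4, 1` up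
  -- to a scalar, and `d (-2)` their negatives.
  have x0 : d 2 0 = -4 * d 2 (-1) := by
    have a := r2 (-1)
    norm_num [v1, w3, w5] at a
    linear_combination a
  have x1 : d 2 1 = 6 * d 2 (-1) := by
    have a := r2 0
    norm_num [h1, w1, w6] at a
    linear_combination (1 / 2 : ℂ) * a - (3 / 2 : ℂ) * x0
  have x2 : d 2 2 = -4 * d 2 (-1) := by
    have a := r2 1
    norm_num [h1, w2, w5] at a
    linear_combination (1 / 3 : ℂ) * a - (2 / 3 : ℂ) * x1
  have x3 : d 2 3 = d 2 (-1) := by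
    have a := r2 2
    norm_num [w4, w6, u1] at a
    linear_combination (1 / 4 : ℂ) * a - (1 / 4 : ℂ) * x2
  have y0 : d (-2) (-3) = -d 2 (-1) := by
    have a := r4 (-3)
    norm_num [v3, v2] at a
    linear_combination -a
  have y1 : d (-2) (-2) = 4 * d 2 (-1) := by
    have a := r4 (-2)
    norm_num [v3, v2, x0] at a
    linear_combination (-1 / 2 : ℂ) * a
  have y2 : d (-2) (-1) = -6 * d 2 (-1) := by
    have a := r4 (-1)
    norm_num [y0, x1] at a
    linear_combination (-1 / 3 : ℂ) * a
  have y3 : d (-2) 0 = 4 * d 2 (-1) := by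
    have a := r4 0
    norm_num [y1, x0, x2] at a
    linear_combination (-1 / 4 : ℂ) * a
  have y4 : d (-2) 1 = -d 2 (-1) := by
    have a := r4 1
    norm_num [y2, x1, x3] at a
    linear_combination (-1 / 5 : ℂ) * a
  obtain ⟨t, ht⟩ : ∃ t, d 2 (-1) = t := ⟨_, rfl⟩
  rw [ht] at x0 x1 x2 x3 y0 y1 y2 y3 y4
  -- The multiple by `t` of the `sl₂`-invariant: `l 1` and `l (-1)` kill it, and its coboundary at
  -- `l 2` and `l (-2)` has the coefficients just found.
  obtain ⟨r, ra, rb, rc, rz⟩ : ∃ r : ℤ → ℂ, r (-1) = t ∧ r 0 = -2 * t ∧ r 1 = t ∧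
      ∀ p, p ≤ -2 ∨ 2 ≤ p → r p = 0 :=
    ⟨fun p => if p = -1 then t else if p = 0 then -2 * t else if p = 1 then t else 0,
      by simp, by simp, by simp, fun p hp => by
        dsimp only
        rw [if_neg (by omega), if_neg (by omega), if_neg (by omega)]⟩
  refine ⟨r, (Set.finite_Icc (-1 : ℤ) 1).subset fun p hp => ?_, ?_⟩
  · by_contra hc
    rw [Set.mem_Icc] at hc
    exact hp (rz p (by omega))
  · have window (m : ℤ) (hm : -2 ≤ m ∧ m ≤ 2) (hout : ∀ p, p ≤ -4 ∨ 4 ≤ p → d m p = 0)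
        (hin : ∀ p, -3 ≤ p → p ≤ 3 → (d - diagonalCoboundary r) m p = 0) :
        (d - diagonalCoboundary r) m = 0 := by
      funext p
      by_cases hp : p ≤ -4 ∨ 4 ≤ p
      · simp only [Pi.sub_apply, diagonalCoboundary, Pi.zero_apply]
        rw [hout p hp, rz p (by omega), rz (p - m) (by omega)]
        ring
      · exact hin p (by omega) (by omega)
    rw [← sub_eq_zero]
    funext m
    refine (hd.sub (isDiagonalCocycle_diagonalCoboundary _)).eq_zero ?_ ?_ ?_ ?_ ?_ m
    · funext p
      simp [diagonalCoboundary, h0]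
    · refine window 1 (by norm_num) (fun p hp => h1 p (by omega) (by omega)) fun p ha hb => ?_
      simp only [Pi.sub_apply, diagonalCoboundary]
      interval_cases p <;> norm_num [h1, w3, w4, ra, rb, rc, rz]
    · refine window 2 (by norm_num) (fun p hp => hp.elim (fun h => v2 p (by omega)) (u2 p))
        fun p ha hb => ?_
      simp only [Pi.sub_apply, diagonalCoboundary]
      interval_cases p <;> norm_num [v2, ht, x0, x1, x2, x3, ra, rb, rc, rz] <;> ring
    · refine window (-1) (by norm_num) (fun p hp => hp.elim (fun h => v1 p (by omega))
        (fun h => u1 p (by omega))) fun p ha hb => ?_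
      simp only [Pi.sub_apply, diagonalCoboundary]
      interval_cases p <;> norm_num [u1, v1, w1, w2, w5, w6, ra, rb, rc, rz]
    · refine window (-2) (by norm_num) (fun p hp => hp.elim (v3 p) (fun h => u3 p (by omega)))
        fun p ha hb => ?_
      simp only [Pi.sub_apply, diagonalCoboundary]
      interval_cases p <;> norm_num [u3, v3, y0, y1, y2, y3, y4, ra, rb, rc, rz] <;> ring

/-- A finitely supported weight-zero cocycle vanishing at `l_0` is inner. -/
theorem IsDiagonalCocycle.exists_eq {d : ℤ → ℤ → ℂ} (hd : IsDiagonalCocycle d)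
    (hfin : ∀ m, (d m).support.Finite) (h0 : d 0 = 0) :
    ∃ r : ℤ → ℂ, r.support.Finite ∧ d = diagonalCoboundary r := by
  obtain ⟨r, hr⟩ := exists_diagonalCoboundary_one_eq (Finsupp.ofSupportFinite (d 1) (hfin 1))
  have hr' : (r : ℤ → ℂ).support.Finite := r.hasFiniteSupport
  obtain ⟨s, hs, hds⟩ := (hd.sub (isDiagonalCocycle_diagonalCoboundary r)).exists_eq_of_normalized
    (fun m => ((hfin m).union (finite_support_diagonalCoboundary hr' m)).subset
      (Function.support_sub _ _))
    (by funext p; simp [diagonalCoboundary, h0])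
    (fun p h1 h2 => sub_eq_zero.mpr (hr p h1 h2))
  refine ⟨s + r, (hs.union hr').subset (Function.support_add _ _), ?_⟩
  rw [diagonalCoboundary_add, ← hds, sub_add_cancel]

/-- A finitely supported 1-cocycle of the Witt algebra with values in the tensor square of its
adjoint module is inner. -/
theorem exists_eq_of_tensor_cocycle {D : ℤ → ℤ × ℤ → ℂ} (hfin : ∀ m, (D m).support.Finite)
    (h : ∀ m n p q : ℤ, ((m : ℂ) - n) * D (m + n) (p, q) =
      ((2 * m - p) * D n (p - m, q) + (2 * m - q) * D n (p, q - m))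
        - ((2 * n - p) * D m (p - n, q) + (2 * n - q) * D m (p, q - n))) :
    ∃ r : ℤ × ℤ → ℂ, r.support.Finite ∧ ∀ m p q : ℤ,
      D m (p, q) = (2 * m - p) * r (p - m, q) + (2 * m - q) * r (p, q - m) := by
  -- `l 0` acts by `-(p + q)`, so this removes the part of `D 0` of nonzero weight. Division by zero
  -- gives `0`, which leaves weight zero untouched.
  obtain ⟨r, hr⟩ : ∃ r : ℤ × ℤ → ℂ, r = fun x => -D 0 x / (x.1 + x.2 : ℂ) := ⟨_, rfl⟩
  have hrfin : r.support.Finite := (hfin 0).subset fun x hx h0 => hx (by simp [hr, h0])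
  obtain ⟨D', hD'⟩ : ∃ D' : ℤ → ℤ × ℤ → ℂ, ∀ m p q, D' m (p, q) = D m (p, q) -
      ((2 * m - p) * r (p - m, q) + (2 * m - q) * r (p, q - m)) :=
    ⟨fun m x => D m x - ((2 * m - x.1) * r (x.1 - m, x.2) + (2 * m - x.2) * r (x.1, x.2 - m)),
      fun _ _ _ => rfl⟩
  have h' (m n p q : ℤ) : ((m : ℂ) - n) * D' (m + n) (p, q) =
      ((2 * m - p) * D' n (p - m, q) + (2 * m - q) * D' n (p, q - m))
        - ((2 * n - p) * D' m (p - n, q) + (2 * n - q) * D' m (p, q - n)) := by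
    simp only [hD', sub_sub, add_comm n m]
    push_cast
    linear_combination h m n p q
  have hfin' (m : ℤ) : (D' m).support.Finite := by
    have i1 : Function.Injective fun x : ℤ × ℤ => (x.1 - m, x.2) := fun x y hxy => by
      simp only [Prod.mk.injEq] at hxy
      ext <;> omega
    have i2 : Function.Injective fun x : ℤ × ℤ => (x.1, x.2 - m) := fun x y hxy => by
      simp only [Prod.mk.injEq] at hxy
      ext <;> omega
    refine ((hfin m).union ((hrfin.preimage i1.injOn).union (hrfin.preimage i2.injOn))).subset ?_
    rintro ⟨p, q⟩ hx
    by_contra hc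
    simp only [Set.mem_union, Set.mem_preimage, Function.mem_support, not_or, not_not] at hc
    exact hx (by simp [hD', hc])
  have hz (p q : ℤ) (hpq : p + q ≠ 0) : D' 0 (p, q) = 0 := by
    have hpq' : (p : ℂ) + q ≠ 0 := by exact_mod_cast hpq
    simp only [hD', hr, sub_zero, Int.cast_zero]
    field_simp
    ring
  -- In weight `m` the cocycle relation for `l m` and `l 0` reduces to `l m · D' 0 = 0`; in other
  -- weights this holds because `D' 0` has weight zero.
  have hinv : D' 0 = 0 := by
    funext ⟨p, q⟩
    refine eq_zero_of_tensor_invariant (hfin' 0) (fun m p q => ?_) p q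
    by_cases hpq : p + q = m
    · have := h' m 0 p q
      rw [add_zero] at this
      subst hpq
      push_cast at this ⊢
      simp only [sub_zero] at this
      linear_combination -this
    · rw [hz _ _ (by omega), hz _ _ (by omega)]
      ring
  -- With `D' 0 = 0` the cocycle commutes with `l 0`, hence preserves weight.
  have hwt (m p q : ℤ) (hpq : p + q ≠ m) : D' m (p, q) = 0 := by
    have hne : (p : ℂ) + q - m ≠ 0 := by exact_mod_cast sub_ne_zero.mpr hpq
    have := h' m 0 p q
    rw [hinv, add_zero, sub_zero, sub_zero] at this
    simp only [Pi.zero_apply, Int.cast_zero] at this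
    exact mul_left_cancel₀ hne (by linear_combination -this)
  obtain ⟨s, hs, hds⟩ := IsDiagonalCocycle.exists_eq (d := fun m p => D' m (p, m - p))
    (fun m n p => by
      have := h' m n p (m + n - p)
      rw [show m + n - p - m = n - p by ring, show m + n - p - n = m - p by ring] at this
      dsimp only
      rw [show n - (p - m) = m + n - p by ring, show m - (p - n) = m + n - p by ring]
      push_cast at this
      linear_combination this)
    (fun m => (hfin' m).preimage (f := fun p => (p, m - p)) fun x _ y _ hxy =>
      congrArg Prod.fst hxy)
    (by funext p; simp [hinv])
  refine ⟨fun x => r x + if x.1 + x.2 = 0 then s x.1 else 0, ?_, fun m p q => ?_⟩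
  · refine (hrfin.union (hs.image fun p => (p, -p))).subset ?_
    rintro ⟨p, q⟩ hx
    by_contra hc
    simp only [Set.mem_union, not_or, Function.mem_support, not_not] at hc
    refine hx ?_
    dsimp only
    rw [hc.1, zero_add]
    split_ifs with hpq
    · by_contra hsp
      exact hc.2 ⟨p, hsp, by ext <;> simp; omega⟩
    · rfl
  · have e := hD' m p q
    dsimp only
    by_cases hpq : p + q = m
    · rw [if_pos (by omega), if_pos (by omega)]
      have e2 := congrFun (congrFun hds m) p
      rw [show m - p = q by omega] at e2
      rw [e2, diagonalCoboundary, ← hpq] at e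
      rw [← hpq]
      push_cast at e ⊢
      linear_combination -e
    · rw [if_neg (by omega), if_neg (by omega)]
      rw [hwt m p q hpq] at e
      linear_combination -e

/-! ### Coordinates on the exterior square and the action of `l m` on them -/

open scoped TensorProduct in
/-- The antisymmetrization `a ∧ b ↦ a ⊗ b - b ⊗ a`. -/
noncomputable def ExteriorSquare.toTensor (R M : Type*) [CommRing R] [AddCommGroup M]
    [Module R M] : ExteriorSquare R M →ₗ[R] M ⊗[R] M :=
  exteriorPower.alternatingMapLinearEquiv
    { toFun := fun v => v 0 ⊗ₜ[R] v 1 - v 1 ⊗ₜ[R] v 0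
      map_update_add' := fun v i a b => by
        rename_i inst
        obtain rfl := Subsingleton.elim inst (instDecidableEqFin 2)
        fin_cases i <;> simp [TensorProduct.add_tmul, TensorProduct.tmul_add] <;> abel
      map_update_smul' := fun v i c a => by
        rename_i inst
        obtain rfl := Subsingleton.elim inst (instDecidableEqFin 2)
        fin_cases i <;> simp [TensorProduct.smul_tmul', smul_sub]
      map_eq_zero_of_eq' := fun v i j h hij => by
        have h01 : v 0 = v 1 := by
          fin_cases i <;> fin_cases j <;> simp_all
        rw [h01, sub_self] } ∘ₗ exteriorSquareEquiv.symm.toLinearMap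

theorem ExteriorSquare.toTensor_wedge {R M : Type*} [CommRing R] [AddCommGroup M]
    [Module R M] (a b : M) :
    ExteriorSquare.toTensor R M (wedge R a b) = a ⊗ₜ[R] b - b ⊗ₜ[R] a :=
  exteriorPower.alternatingMapLinearEquiv_apply_ιMulti _ _

/-- The map `a ⊗ b ↦ a ∧ b`. -/
noncomputable def ExteriorSquare.ofTensor (R M : Type*) [CommRing R] [AddCommGroup M]
    [Module R M] : TensorProduct R M M →ₗ[R] ExteriorSquare R M :=
  TensorProduct.lift (LinearMap.mk₂ R (wedge R) wedge_add_left wedge_smul_left wedge_add_right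
    wedge_smul_right)

/-- Makes antisymmetrization injective when `2` is invertible, so tensor coordinates separate
elements of the exterior square and no order on the basis is needed. -/
theorem ExteriorSquare.ofTensor_toTensor {R M : Type*} [CommRing R] [AddCommGroup M]
    [Module R M] (t : ExteriorSquare R M) :
    ExteriorSquare.ofTensor R M (ExteriorSquare.toTensor R M t) = (2 : R) • t := by
  have : ExteriorSquare.ofTensor R M ∘ₗ ExteriorSquare.toTensor R M =
      (2 : R) • LinearMap.id := by
    refine exteriorSquare_hom_ext fun a b => ?_
    simp only [LinearMap.comp_apply, ExteriorSquare.toTensor_wedge, map_sub,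
      ExteriorSquare.ofTensor, TensorProduct.lift.tmul, LinearMap.mk₂_apply, LinearMap.smul_apply,
      LinearMap.id_apply]
    rw [wedge_swap b a, sub_neg_eq_add, two_smul]
  exact LinearMap.congr_fun this t

namespace BMS3c

/-- The coordinates of an element of the exterior square, as a skew-symmetric matrix. -/
noncomputable def wedgeCoord (i j : BMSIndex) : ExteriorSquare ℂ BMS3c →ₗ[ℂ] ℂ :=
  (basis.tensorProduct basis).coord (i, j) ∘ₗ ExteriorSquare.toTensor ℂ BMS3c

theorem wedgeCoord_wedge (i j : BMSIndex) (a b : BMS3c) : wedgeCoord i j (wedge ℂ a b) =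
    basis.repr a i * basis.repr b j - basis.repr b i * basis.repr a j := by
  simp [wedgeCoord, ExteriorSquare.toTensor_wedge, Module.Basis.tensorProduct_repr_tmul_apply,
    mul_comm]

theorem wedgeCoord_swap (i j : BMSIndex) (t : ExteriorSquare ℂ BMS3c) :
    wedgeCoord i j t = -wedgeCoord j i t := by
  have : wedgeCoord i j = -wedgeCoord j i := exteriorSquare_hom_ext fun a b => by
    simp only [LinearMap.neg_apply, wedgeCoord_wedge]
    ring
  exact LinearMap.congr_fun this t

theorem finite_support_wedgeCoord (t : ExteriorSquare ℂ BMS3c) :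
    (fun x : BMSIndex × BMSIndex => wedgeCoord x.1 x.2 t).support.Finite :=
  ((basis.tensorProduct basis).repr (ExteriorSquare.toTensor ℂ BMS3c t)).hasFiniteSupport

theorem eq_zero_of_wedgeCoord_eq_zero {t : ExteriorSquare ℂ BMS3c}
    (h : ∀ i j, wedgeCoord i j t = 0) : t = 0 := by
  have h1 : ExteriorSquare.toTensor ℂ BMS3c t = 0 :=
    (basis.tensorProduct basis).ext_elem fun x => by
      rw [map_zero]
      exact h x.1 x.2
  have h2 := ExteriorSquare.ofTensor_toTensor t
  rw [h1, map_zero] at h2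
  exact (smul_eq_zero.mp h2.symm).resolve_left two_ne_zero

/-- The labels of the non-central basis elements: `l p` for `false` and `T p` for `true`. -/
def index : Bool → ℤ → BMSIndex
  | false, p => .l p
  | true, p => .T p

theorem index_inj {x y : Bool} {p q : ℤ} : index x p = index y q ↔ x = y ∧ p = q := by
  cases x <;> cases y <;> simp [index]

theorem index_ne_c (x : Bool) (p : ℤ) : index x p ≠ .c := by
  cases x <;> simp [index]

theorem finite_support_wedgeCoord_index (t : ExteriorSquare ℂ BMS3c) (x y : Bool) :
    (fun z : ℤ × ℤ => wedgeCoord (index x z.1) (index y z.2) t).support.Finite :=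
  (finite_support_wedgeCoord t).preimage (f := fun z : ℤ × ℤ => (index x z.1, index y z.2))
    fun _ _ _ _ hzw => Prod.ext (index_inj.mp (congrArg Prod.fst hzw)).2
      (index_inj.mp (congrArg Prod.snd hzw)).2

theorem finite_support_wedgeCoord_c_index (t : ExteriorSquare ℂ BMS3c) (x : Bool) :
    (fun q : ℤ => wedgeCoord .c (index x q) t).support.Finite :=
  (finite_support_wedgeCoord t).preimage (f := fun q : ℤ => (BMSIndex.c, index x q))
    fun _ _ _ _ hpq => (index_inj.mp (congrArg Prod.snd hpq)).2

theorem eq_c_or_exists_index (i : BMSIndex) : i = .c ∨ ∃ x p, i = index x p := by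
  rcases i with p | p | _
  exacts [Or.inr ⟨false, p, rfl⟩, Or.inr ⟨true, p, rfl⟩, Or.inl rfl]

theorem eq_zero_of_wedgeCoord_index_eq_zero {t : ExteriorSquare ℂ BMS3c}
    (h : ∀ x y p q, wedgeCoord (index x p) (index y q) t = 0)
    (hc : ∀ x q, wedgeCoord .c (index x q) t = 0) : t = 0 := by
  have hcc : wedgeCoord .c .c t = 0 := self_eq_neg.mp (wedgeCoord_swap _ _ t)
  refine eq_zero_of_wedgeCoord_eq_zero fun i j => ?_
  rcases eq_c_or_exists_index i with rfl | ⟨x, p, rfl⟩ <;> rcases eq_c_or_exists_index j with rfl | ⟨y, q, rfl⟩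
  · exact hcc
  · exact hc y q
  · rw [wedgeCoord_swap, hc, neg_zero]
  · exact h x y p q

theorem repr_basis_index (x y : Bool) (p q : ℤ) :
    basis.repr (basis (index x p)) (index y q) = if x = y ∧ p = q then 1 else 0 := by
  classical
  rw [Module.Basis.repr_self, Finsupp.single_apply]
  simp only [index_inj]

theorem repr_basis_index_c (x : Bool) (p : ℤ) : basis.repr (basis (index x p)) .c = 0 := by
  classical
  rw [Module.Basis.repr_self, Finsupp.single_apply, if_neg (index_ne_c x p)]

theorem repr_c_index (x : Bool) (p : ℤ) : basis.repr c (index x p) = 0 := by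
  classical
  rw [c, Module.Basis.repr_self, Finsupp.single_apply, if_neg (index_ne_c x p).symm]

theorem repr_c_c : basis.repr c .c = 1 := by
  rw [c, Module.Basis.repr_self, Finsupp.single_eq_same]

theorem lie_l_basis_index (m : ℤ) (x : Bool) (n : ℤ) : ⁅l m, (basis (index x n) : BMS3c)⁆ =
    ((m : ℂ) - n) • basis (index x (m + n)) +
      (if x = true ∧ m + n = 0 then (m : ℂ) ^ 3 - m else 0) • c := by
  cases x
  · rw [if_neg (by simp), zero_smul, add_zero]
    exact lie_l_l m n
  · simp only [true_and]
    exact lie_l_T m n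

theorem repr_lie_l_index (m : ℤ) (a : BMS3c) (x : Bool) (p : ℤ) :
    basis.repr ⁅l m, a⁆ (index x p) = (2 * m - p) * basis.repr a (index x (p - m)) := by
  have : basis.coord (index x p) ∘ₗ bracketHom (l m) =
      (2 * (m : ℂ) - p) • basis.coord (index x (p - m)) := by
    refine basis.ext fun i => ?_
    rcases eq_c_or_exists_index i with rfl | ⟨y, n, rfl⟩
    · change basis.repr (bracketHom (l m) c) _ = (_ : ℂ) * basis.repr c _
      rw [bracketHom_c_right, repr_c_index, map_zero, Finsupp.zero_apply, mul_zero]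
    · have := lie_l_basis_index m y n
      change bracketHom (l m) _ = _ at this
      simp only [LinearMap.comp_apply, this, map_add, map_smul, LinearMap.smul_apply,
        Module.Basis.coord_apply, repr_basis_index, repr_c_index, smul_eq_mul, mul_zero, add_zero]
      by_cases hxy : y = x ∧ m + n = p
      · obtain ⟨rfl, rfl⟩ := hxy
        rw [if_pos ⟨rfl, rfl⟩, if_pos ⟨rfl, by omega⟩]
        push_cast
        ring
      · rw [if_neg hxy, if_neg (fun h => hxy ⟨h.1, by omega⟩)]
        ring
  exact LinearMap.congr_fun this a

/-- The multiples of `c` form a submodule, so the non-central coordinates transform as in the tensor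
square of the adjoint Witt module. -/
theorem wedgeCoord_lie_l (m : ℤ) (t : ExteriorSquare ℂ BMS3c) (x y : Bool) (p q : ℤ) :
    wedgeCoord (index x p) (index y q) ⁅l m, t⁆ =
      (2 * m - p) * wedgeCoord (index x (p - m)) (index y q) t +
        (2 * m - q) * wedgeCoord (index x p) (index y (q - m)) t := by
  have : wedgeCoord (index x p) (index y q) ∘ₗ exteriorSquareAction (l m) =
      (2 * (m : ℂ) - p) • wedgeCoord (index x (p - m)) (index y q) +
        (2 * (m : ℂ) - q) • wedgeCoord (index x p) (index y (q - m)) := by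
    refine exteriorSquare_hom_ext fun a b => ?_
    simp only [LinearMap.comp_apply, exteriorSquareAction_wedge, map_add, wedgeCoord_wedge,
      repr_lie_l_index, LinearMap.add_apply, LinearMap.smul_apply, smul_eq_mul]
    ring
  exact LinearMap.congr_fun this t

theorem repr_lie_l_c (m : ℤ) (a : BMS3c) :
    basis.repr ⁅l m, a⁆ .c = ((m : ℂ) ^ 3 - m) * basis.repr a (index true (-m)) := by
  have : basis.coord .c ∘ₗ bracketHom (l m) =
      ((m : ℂ) ^ 3 - m) • basis.coord (index true (-m)) := by
    refine basis.ext fun i => ?_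
    rcases eq_c_or_exists_index i with rfl | ⟨y, n, rfl⟩
    · change basis.repr (bracketHom (l m) c) _ = (_ : ℂ) * basis.repr c _
      rw [bracketHom_c_right, repr_c_index, map_zero, Finsupp.zero_apply, mul_zero]
    · have := lie_l_basis_index m y n
      change bracketHom (l m) _ = _ at this
      simp only [LinearMap.comp_apply, this, map_add, map_smul, LinearMap.smul_apply,
        Module.Basis.coord_apply, repr_basis_index, repr_basis_index_c, repr_c_c, smul_eq_mul,
        mul_zero, zero_add, mul_one]
      by_cases hxy : y = true ∧ m + n = 0
      · rw [if_pos hxy, if_pos ⟨hxy.1, by omega⟩, mul_one]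
      · rw [if_neg hxy, if_neg (fun h => hxy ⟨h.1, by omega⟩), mul_zero]
  exact LinearMap.congr_fun this a

/-- The central extension contributes the first term. It disappears once the non-central coordinates
vanish, which is why those are always treated first. -/
theorem wedgeCoord_lie_l_c (m : ℤ) (t : ExteriorSquare ℂ BMS3c) (y : Bool) (q : ℤ) :
    wedgeCoord .c (index y q) ⁅l m, t⁆ =
      ((m : ℂ) ^ 3 - m) * wedgeCoord (index true (-m)) (index y q) t +
        (2 * m - q) * wedgeCoord .c (index y (q - m)) t := by
  have : wedgeCoord .c (index y q) ∘ₗ exteriorSquareAction (l m) =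
      ((m : ℂ) ^ 3 - m) • wedgeCoord (index true (-m)) (index y q) +
        (2 * (m : ℂ) - q) • wedgeCoord .c (index y (q - m)) := by
    refine exteriorSquare_hom_ext fun a b => ?_
    simp only [LinearMap.comp_apply, exteriorSquareAction_wedge, map_add, wedgeCoord_wedge,
      repr_lie_l_index, repr_lie_l_c, LinearMap.add_apply, LinearMap.smul_apply, smul_eq_mul]
    ring
  exact LinearMap.congr_fun this t

theorem exists_wedgeCoord_eq {f : Bool → Bool → ℤ × ℤ → ℂ} (hf : ∀ x y, (f x y).support.Finite) :
    ∃ t : ExteriorSquare ℂ BMS3c, ∀ x y p q, wedgeCoord (index x p) (index y q) t =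
      f x y (p, q) - f y x (q, p) := by
  have hsingle (x y : Bool) (g : ℤ × ℤ →₀ ℂ) : ∃ t : ExteriorSquare ℂ BMS3c, ∀ x' y' p q,
      wedgeCoord (index x' p) (index y' q) t =
        (if x = x' ∧ y = y' then g (p, q) else 0) - if x = y' ∧ y = x' then g (q, p) else 0 := by
    induction g using Finsupp.induction_linear with
    | zero => exact ⟨0, fun x' y' p q => by simp⟩
    | add g g' h h' =>
      obtain ⟨t, ht⟩ := h
      obtain ⟨t', ht'⟩ := h'
      refine ⟨t + t', fun x' y' p q => ?_⟩
      rw [map_add, ht, ht', Finsupp.add_apply, Finsupp.add_apply]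
      split_ifs <;> ring
    | single k a =>
      obtain ⟨k1, k2⟩ := k
      refine ⟨a • wedge ℂ (basis (index x k1)) (basis (index y k2)), fun x' y' p q => ?_⟩
      rw [map_smul, wedgeCoord_wedge]
      simp only [repr_basis_index, Finsupp.single_apply, smul_eq_mul, Prod.mk.injEq]
      split_ifs <;> first | omega | grind
  choose T hT using fun x y => hsingle x y (Finsupp.ofSupportFinite (f x y) (hf x y))
  refine ⟨∑ x, ∑ y, T x y, fun x y p q => ?_⟩
  simp only [map_add, hT, Fintype.sum_bool, Finsupp.ofSupportFinite_coe]
  cases x <;> cases y <;> simp <;> ring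

theorem exists_wedgeCoord_c_eq {f : Bool → ℤ → ℂ} (hf : ∀ x, (f x).support.Finite) :
    ∃ t : ExteriorSquare ℂ BMS3c, (∀ x y p q, wedgeCoord (index x p) (index y q) t = 0) ∧
      ∀ x q, wedgeCoord .c (index x q) t = f x q := by
  have hsingle (x : Bool) (g : ℤ →₀ ℂ) : ∃ t : ExteriorSquare ℂ BMS3c,
      (∀ x y p q, wedgeCoord (index x p) (index y q) t = 0) ∧
      ∀ x' q, wedgeCoord .c (index x' q) t = if x = x' then g q else 0 := by
    induction g using Finsupp.induction_linear with
    | zero => exact ⟨0, by simp, by simp⟩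
    | add g g' h h' =>
      obtain ⟨t, h0, ht⟩ := h
      obtain ⟨t', h0', ht'⟩ := h'
      refine ⟨t + t', fun x' y' p q => by rw [map_add, h0, h0', add_zero], fun x' q => ?_⟩
      rw [map_add, ht, ht', Finsupp.add_apply]
      split_ifs <;> ring
    | single k a =>
      refine ⟨a • wedge ℂ c (basis (index x k)), fun x' y' p q => ?_, fun x' q => ?_⟩
      · rw [map_smul, wedgeCoord_wedge]
        simp [repr_c_index]
      · rw [map_smul, wedgeCoord_wedge]
        simp only [repr_basis_index, repr_basis_index_c, repr_c_index, repr_c_c,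
          Finsupp.single_apply, smul_eq_mul]
        split_ifs <;> first | omega | grind
  choose T h0 hT using fun x => hsingle x (Finsupp.ofSupportFinite (f x) (hf x))
  refine ⟨∑ x, T x, fun x y p q => ?_, fun x q => ?_⟩
  · simp only [map_add, h0, Fintype.sum_bool, add_zero]
  · simp only [map_add, hT, Fintype.sum_bool, Finsupp.ofSupportFinite_coe]
    cases x <;> simp

end BMS3c

/-! ### Cocycles of the BMS algebra -/

theorem mem_oneCocycles_iff {R L M : Type*} [CommRing R] [LieRing L] [LieAlgebra R L]
    [AddCommGroup M] [Module R M] [LieRingModule L M] [LieModule R L M] {δ : L →ₗ[R] M} :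
    δ ∈ oneCocycles R L M ↔ ∀ x y, δ ⁅x, y⁆ = ⁅x, δ y⁆ - ⁅y, δ x⁆ := by
  rw [oneCocycles, LinearMap.mem_ker]
  refine ⟨fun h x y => ?_, fun h => ?_⟩
  · have := LieModule.Cohomology.d₁₂_apply_apply R L M δ x y
    rw [h] at this
    exact (sub_eq_zero.mp this.symm).symm
  · ext x y
    simp [h x y]

namespace BMS3c

theorem c_lie (x : BMS3c) : ⁅c, x⁆ = 0 := bracketHom_c_left x

theorem c_lie_exteriorSquare (t : ExteriorSquare ℂ BMS3c) : ⁅c, t⁆ = 0 := by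
  have : exteriorSquareAction c = (0 : Module.End ℂ (ExteriorSquare ℂ BMS3c)) :=
    exteriorSquare_hom_ext fun a b => by
      have hz (u : BMS3c) : wedge ℂ 0 u = 0 := by simpa using wedge_smul_left (0 : ℂ) (0 : BMS3c) u
      rw [exteriorSquareAction_wedge, c_lie, c_lie, hz, wedge_swap, hz]
      simp
  exact LinearMap.congr_fun this t

theorem eq_zero_of_lie_l_eq_zero {t : ExteriorSquare ℂ BMS3c} (h : ∀ m, ⁅l m, t⁆ = 0) :
    t = 0 := by
  have h1 (x y : Bool) (p q : ℤ) : wedgeCoord (index x p) (index y q) t = 0 := by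
    refine eq_zero_of_tensor_invariant
      (f := fun z => wedgeCoord (index x z.1) (index y z.2) t) ?_ (fun m p q => ?_) p q
    · exact finite_support_wedgeCoord_index t x y
    · rw [← wedgeCoord_lie_l, h, map_zero]
  refine eq_zero_of_wedgeCoord_index_eq_zero h1 fun x q => ?_
  refine eq_zero_of_adjoint_invariant (s := fun q => wedgeCoord .c (index x q) t)
    (fun m q => ?_) q
  have := wedgeCoord_lie_l_c m t x q
  rw [h, map_zero, h1, mul_zero, zero_add] at this
  exact this.symm

/-- On the span of the `l m`, every cocycle is inner. -/
theorem exists_eq_lie_l {δ : BMS3c →ₗ[ℂ] ExteriorSquare ℂ BMS3c}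
    (hδ : δ ∈ oneCocycles ℂ BMS3c (ExteriorSquare ℂ BMS3c)) : ∃ r, ∀ m, δ (l m) = ⁅l m, r⁆ := by
  have hl (m n : ℤ) : ((m : ℂ) - n) • δ (l (m + n)) = ⁅l m, δ (l n)⁆ - ⁅l n, δ (l m)⁆ := by
    rw [← map_smul, ← lie_l_l, mem_oneCocycles_iff.mp hδ]
  have hD (x y : Bool) := exists_eq_of_tensor_cocycle
    (D := fun m z => wedgeCoord (index x z.1) (index y z.2) (δ (l m)))
    (fun m => finite_support_wedgeCoord_index _ x y)
    (fun m n p q => by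
      have := congrArg (wedgeCoord (index x p) (index y q)) (hl m n)
      rwa [map_smul, map_sub, wedgeCoord_lie_l, wedgeCoord_lie_l, smul_eq_mul] at this)
  choose f hf hfD using hD
  obtain ⟨t, ht⟩ := exists_wedgeCoord_eq hf
  -- The tensor-square primitives `f x y` need not be skew. Antisymmetrizing them doubles the
  -- coboundary, because the coordinates of `δ (l m)` are skew; hence the factor `1 / 2`.
  obtain ⟨ε, hε⟩ : ∃ ε : ℤ → ExteriorSquare ℂ BMS3c,
      ∀ m, ε m = δ (l m) - ⁅l m, (1 / 2 : ℂ) • t⁆ := ⟨_, fun _ => rfl⟩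
  have hεcoord (m : ℤ) (x y : Bool) (p q : ℤ) :
      wedgeCoord (index x p) (index y q) (ε m) = 0 := by
    have e1 := hfD x y m p q
    have e2 := hfD y x m q p
    have e3 := wedgeCoord_swap (index x p) (index y q) (δ (l m))
    simp only at e1 e2
    rw [hε, map_sub, wedgeCoord_lie_l, map_smul, map_smul, ht, ht, smul_eq_mul, smul_eq_mul]
    linear_combination (1 / 2 : ℂ) * e1 - (1 / 2 : ℂ) * e2 + (1 / 2 : ℂ) * e3
  have hεl (m n : ℤ) : ((m : ℂ) - n) • ε (m + n) = ⁅l m, ε n⁆ - ⁅l n, ε m⁆ := by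
    have e := lie_lie (l m) (l n) ((1 / 2 : ℂ) • t)
    rw [lie_l_l, smul_lie] at e
    rw [hε, hε, hε, smul_sub, hl, e, lie_sub, lie_sub]
    abel
  have hE (x : Bool) := exists_eq_of_adjoint_cocycle
    (E := fun m q => wedgeCoord .c (index x q) (ε m))
    (finite_support_wedgeCoord_c_index _ x)
    (fun m n q => by
      have := congrArg (wedgeCoord .c (index x q)) (hεl m n)
      rwa [map_smul, map_sub, wedgeCoord_lie_l_c, wedgeCoord_lie_l_c, hεcoord, hεcoord, mul_zero,
        mul_zero, zero_add, zero_add, smul_eq_mul] at this)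
  choose s hs hsE using hE
  obtain ⟨u, hu0, hu⟩ := exists_wedgeCoord_c_eq hs
  refine ⟨(1 / 2 : ℂ) • t + u, fun m => ?_⟩
  have : ε m - ⁅l m, u⁆ = 0 := by
    refine eq_zero_of_wedgeCoord_index_eq_zero (fun x y p q => ?_) fun x q => ?_
    · rw [map_sub, hεcoord, wedgeCoord_lie_l, hu0, hu0]
      ring
    · have e := hsE x m q
      rw [map_sub, wedgeCoord_lie_l_c, hu0, hu, e]
      ring
  rw [hε, sub_sub, ← lie_add] at this
  exact sub_eq_zero.mp this

/-- Conceptually `delta α` is `x ↦ α c ∧ D x`, where `D` is the derivation with `l m ↦ 0`, `T m ↦ T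
m`, `c ↦ c`. The element `c` is invariant and `c ∧ c = 0`. The check itself runs over pairs of basis
elements. -/
theorem delta_mem_oneCocycles (α : ℂ) :
    delta α ∈ oneCocycles ℂ BMS3c (ExteriorSquare ℂ BMS3c) := by
  have hz (u : BMS3c) : wedge ℂ u 0 = 0 := by simpa using wedge_smul_right (0 : ℂ) u (0 : BMS3c)
  have hz' (u : BMS3c) : wedge ℂ 0 u = 0 := by rw [wedge_swap, hz, neg_zero]
  have hlT (m n : ℤ) : delta α ⁅l m, T n⁆ = ⁅l m, delta α (T n)⁆ := by
    rw [lie_l_T, map_add, map_smul, map_smul, delta_T, delta_c, delta_T, smul_zero, add_zero,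
      lie_smul, lie_wedge, lie_c, lie_l_T, wedge_add_right, wedge_smul_right, wedge_smul_right,
      wedge_self, hz', smul_zero, zero_add, add_zero, smul_comm]
  have hTT (m n : ℤ) : ⁅T m, delta α (T n)⁆ = 0 := by
    rw [delta_T, lie_smul, lie_wedge, lie_c, lie_T_T, hz, hz', add_zero, smul_zero]
  have hll (m n : ℤ) : delta α ⁅l m, l n⁆ = 0 := by
    rw [lie_l_l, map_smul, delta_l, smul_zero]
  have key : LieModule.Cohomology.d₁₂ ℂ BMS3c (ExteriorSquare ℂ BMS3c) (delta α) = 0 := by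
    refine Subtype.ext (basis.ext fun i => basis.ext fun j => ?_)
    change ⁅basis i, delta α (basis j)⁆ - ⁅basis j, delta α (basis i)⁆ -
      delta α ⁅(basis i : BMS3c), (basis j : BMS3c)⁆ = 0
    have hl (m : ℤ) : basis (.l m) = l m := rfl
    have hT (m : ℤ) : basis (.T m) = T m := rfl
    have hc : basis .c = c := rfl
    have hTl (m n : ℤ) : ⁅T m, l n⁆ = -⁅l n, T m⁆ := (lie_skew _ _).symm
    rcases i with m | m | _ <;> rcases j with n | n | _ <;>
      simp only [hl, hT, hc, hTl, map_neg, hlT, hTT, hll, lie_T_T, lie_c, c_lie,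
        c_lie_exteriorSquare, delta_l, delta_c, map_zero, lie_zero, sub_zero, zero_sub, sub_self]
  exact key

/-- A cocycle vanishing on every `l m` is one of the `delta α`. -/
theorem exists_eq_delta {δ : BMS3c →ₗ[ℂ] ExteriorSquare ℂ BMS3c}
    (hδ : δ ∈ oneCocycles ℂ BMS3c (ExteriorSquare ℂ BMS3c)) (hl : ∀ m, δ (l m) = 0) :
    ∃ α, δ = delta α := by
  rw [mem_oneCocycles_iff] at hδ
  have hδc : δ c = 0 := eq_zero_of_lie_l_eq_zero fun m => by
    have := hδ (l m) c
    rwa [lie_c, map_zero, c_lie_exteriorSquare, sub_zero, eq_comm] at this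
  have hlT (m n : ℤ) : ((m : ℂ) - n) • δ (T (m + n)) = ⁅l m, δ (T n)⁆ := by
    have := hδ (l m) (T n)
    rwa [lie_l_T, map_add, map_smul, map_smul, hδc, smul_zero, add_zero, hl, lie_zero,
      sub_zero] at this
  have hcoord (n : ℤ) (x y : Bool) (p q : ℤ) :
      wedgeCoord (index x p) (index y q) (δ (T n)) = 0 :=
    eq_zero_of_tensor_hom
      (F := fun n z => wedgeCoord (index x z.1) (index y z.2) (δ (T n)))
      (finite_support_wedgeCoord_index _ x y)
      (fun m n p q => by
        have := congrArg (wedgeCoord (index x p) (index y q)) (hlT m n)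
        rwa [map_smul, wedgeCoord_lie_l, smul_eq_mul] at this) n p q
  have hcoord' (n : ℤ) (x : Bool) (q : ℤ) := eq_of_adjoint_hom
    (F := fun n q => wedgeCoord .c (index x q) (δ (T n)))
    (fun m n q => by
      have := congrArg (wedgeCoord .c (index x q)) (hlT m n)
      rwa [map_smul, wedgeCoord_lie_l_c, hcoord, mul_zero, zero_add, smul_eq_mul] at this) n q
  obtain ⟨β, hβ⟩ : ∃ β, wedgeCoord .c (index true 0) (δ (T 0)) = β := ⟨_, rfl⟩
  obtain ⟨γ, hγ⟩ : ∃ γ, wedgeCoord .c (index false 0) (δ (T 0)) = γ := ⟨_, rfl⟩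
  have hrT (n : ℤ) (x : Bool) (q : ℤ) : basis.repr (T n) (index x q) =
      if true = x ∧ n = q then 1 else 0 := repr_basis_index true x n q
  have hrl (n : ℤ) (x : Bool) (q : ℤ) : basis.repr (l n) (index x q) =
      if false = x ∧ n = q then 1 else 0 := repr_basis_index false x n q
  have hT (n : ℤ) : δ (T n) = β • wedge ℂ c (T n) + γ • wedge ℂ c (l n) := by
    refine sub_eq_zero.mp (eq_zero_of_wedgeCoord_index_eq_zero (fun x y p q => ?_) fun x q => ?_)
    · simp [hcoord, wedgeCoord_wedge, repr_c_index]
    · rw [map_sub, hcoord', map_add, map_smul, map_smul, wedgeCoord_wedge, wedgeCoord_wedge,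
        repr_c_c, repr_c_index, hrT, hrl]
      cases x <;> simp [hβ, hγ, eq_comm (a := q)]
  have hγ0 : γ = 0 := by
    -- The `β` terms drop out because the `T m` commute; what remains is `2 γ c ∧ T 1 = 0`.
    have e := hδ (T 1) (T 0)
    rw [lie_T_T, map_zero, hT, hT] at e
    have e' := congrArg (wedgeCoord .c (index true 1)) e
    have hTl (m n : ℤ) : ⁅T m, l n⁆ = -⁅l n, T m⁆ := (lie_skew _ _).symm
    simp only [lie_add, lie_smul, lie_wedge, lie_c, lie_T_T, hTl, lie_l_T, map_add, map_sub,
      map_smul, map_zero, wedgeCoord_wedge, map_neg, Finsupp.neg_apply, Finsupp.add_apply,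
      Finsupp.smul_apply, repr_c_c, repr_c_index, Finsupp.zero_apply, hrT,
      smul_eq_mul] at e'
    norm_num at e'
    linear_combination (-1 / 2 : ℂ) * e'
  refine ⟨β, basis.ext fun i => ?_⟩
  rcases i with n | n | _
  · exact (hl n).trans (delta_l β n).symm
  · refine (hT n).trans ?_
    rw [hγ0, zero_smul, add_zero]
    exact (delta_T β n).symm
  · exact hδc.trans (delta_c β).symm

theorem delta_notMem_oneCoboundaries {α : ℂ} (hα : α ≠ 0) :
    delta α ∉ oneCoboundaries ℂ BMS3c (ExteriorSquare ℂ BMS3c) := by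
  rintro ⟨r, hr⟩
  have hr' (x : BMS3c) : ⁅x, r⁆ = delta α x := LinearMap.congr_fun hr x
  -- Since `delta α` vanishes on the `l m`, the element `r` is invariant under the Witt algebra.
  have h0 : r = 0 := eq_zero_of_lie_l_eq_zero fun m => (hr' _).trans (delta_l α m)
  have e := hr' (T 0)
  rw [h0, lie_zero, delta_T] at e
  have e' := congrArg (wedgeCoord .c (index true 0)) e
  have hTidx (n : ℤ) : T n = basis (index true n) := rfl
  rw [map_zero, map_smul, wedgeCoord_wedge, repr_c_c, repr_c_index, hTidx, repr_basis_index] at e'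
  exact hα (by simpa using e'.symm)

theorem delta_add (α β : ℂ) : delta (α + β) = delta α + delta β := by
  refine basis.ext fun i => ?_
  rcases i with n | n | _
  · change delta _ (l n) = delta _ (l n) + delta _ (l n)
    simp [delta_l]
  · change delta _ (T n) = delta _ (T n) + delta _ (T n)
    simp [delta_T, add_smul]
  · change delta _ c = delta _ c + delta _ c
    simp [delta_c]

theorem delta_smul (a α : ℂ) : delta (a * α) = a • delta α := by
  refine basis.ext fun i => ?_
  rcases i with n | n | _
  · change delta _ (l n) = a • delta _ (l n)
    simp [delta_l]
  · change delta _ (T n) = a • delta _ (T n)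
    simp [delta_T, mul_smul]
  · change delta _ c = a • delta _ c
    simp [delta_c]

/-- The class of `delta α` in the first cohomology, as a linear function of `α`. -/
noncomputable def deltaClass : ℂ →ₗ[ℂ] H1 ℂ BMS3c (ExteriorSquare ℂ BMS3c) :=
  Submodule.mkQ _ ∘ₗ
    { toFun := fun α => ⟨delta α, delta_mem_oneCocycles α⟩
      map_add' := fun α β => Subtype.ext (delta_add α β)
      map_smul' := fun a α => Subtype.ext (delta_smul a α) }

theorem deltaClass_bijective : Function.Bijective deltaClass := by
  constructor
  · rw [← LinearMap.ker_eq_bot, LinearMap.ker_eq_bot']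
    intro α hα
    by_contra h
    exact delta_notMem_oneCoboundaries h ((Submodule.Quotient.mk_eq_zero
      ((oneCoboundaries ℂ BMS3c (ExteriorSquare ℂ BMS3c)).submoduleOf _)).mp hα)
  · intro ξ
    obtain ⟨⟨δ, hδ⟩, rfl⟩ := Submodule.Quotient.mk_surjective _ ξ
    obtain ⟨r, hr⟩ := exists_eq_lie_l hδ
    have hmem : d₀₁ ℂ BMS3c (ExteriorSquare ℂ BMS3c) r ∈
        oneCoboundaries ℂ BMS3c (ExteriorSquare ℂ BMS3c) := ⟨r, rfl⟩
    obtain ⟨α, hα⟩ := exists_eq_delta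
      (Submodule.sub_mem _ hδ (oneCoboundaries_le_oneCocycles _ _ _ hmem))
      (fun m => sub_eq_zero.mpr (hr m))
    refine ⟨α, Eq.symm ((Submodule.Quotient.eq _).mpr ?_)⟩
    change δ - delta α ∈ oneCoboundaries ℂ BMS3c (ExteriorSquare ℂ BMS3c)
    rwa [← hα, sub_sub_cancel]

end BMS3c

theorem mainTheorem5 :
    ∃ hδ : ∀ α : ℂ, BMS3c.delta α ∈ oneCocycles ℂ BMS3c (ExteriorSquare ℂ BMS3c),
      (∀ α : ℂ, α ≠ 0 → BMS3c.delta α ∉ oneCoboundaries ℂ BMS3c (ExteriorSquare ℂ BMS3c)) ∧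
      (∀ ξ : H1 ℂ BMS3c (ExteriorSquare ℂ BMS3c),
        ∃! α : ℂ, ξ = Submodule.Quotient.mk ⟨BMS3c.delta α, hδ α⟩) ∧
      Module.finrank ℂ (H1 ℂ BMS3c (ExteriorSquare ℂ BMS3c)) = 1 := by
  refine ⟨BMS3c.delta_mem_oneCocycles, fun α hα => BMS3c.delta_notMem_oneCoboundaries hα,
    fun ξ => ?_, ?_⟩
  · obtain ⟨α, hα, huniq⟩ := BMS3c.deltaClass_bijective.existsUnique ξ
    exact ⟨α, hα.symm, fun β hβ => huniq β hβ.symm⟩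
  · rw [← (LinearEquiv.ofBijective _ BMS3c.deltaClass_bijective).finrank_eq, Module.finrank_self]
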